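/- Let $\mathcal M$ be a smooth finite-dimensional Riemannian manifold, and let $f=\frac1n\sum_{i=1}^n f_i$ with $f_i:\mathcal M\to\mathbb R$, $n\ge 1$, where $f$ is three times and each $f_i$ is twice continuously differentiable. For a nonempty $I\subset\{1,\dots,n\}$ write $\operatorname{grad}f_I=\frac1{|I|}\sum_{i\in I}\operatorname{grad}f_i$. Let $R:T\mathcal M\to\mathcal M$ be a retraction, i.e. a smooth map with $R_\omega(0)=\omega$ and $DR_\omega(0)[\xi]=\xi$. Let $\mathcal T$ be a vector transport associated with $R$, i.e. a smooth map $T\mathcal M\oplus T\mathcal M\to T\mathcal M$, $(\eta,\xi)\mapsto\mathcal T_\eta(\xi)\in T_{R_\omega(\eta)}\mathcal M$ for $\eta,\xi\in T_\omega\mathcal M$, which is linear in $\xi$ and satisfies $\mathcal T_{0}(\xi)=\xi$. Assume that $\mathcal T$ is isometric: $\langle\mathcal T_\eta\xi,\mathcal T_\eta\zeta\rangle=\langle\xi,\zeta\rangle$. For $y=R_x(\eta)$ write $\mathcal T_x^y=\mathcal T_\eta$. Fix an integer $m>0$, a number $0<\mu<1$, step sizes $\alpha_t^s>0$ ($s\ge1$,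 $0\le t<m$) with $$\sum_{s=1}^\infty\sum_{t=0}^{m-1}\alpha_t^s=\infty,\qquad \sum_{s=1}^\infty\sum_{t=0}^{m-1}(\alpha_t^s)^2<\infty,$$ and parameters $\phi_t^s,\psi_t^s\ge0$ with $\phi_t^s+\psi_t^s\le1$. Let $I_t^s$ ($s\ge1$, $1\le t<m$) be independent random subsets of $\{1,\dots,n\}$, each uniformly distributed among the subsets of a prescribed cardinality $b_t^s\in\{1,\dots,n\}$. The Riemannian stochastic hybrid gradient algorithm with adaptive parameters starts at a point $\tilde\omega^0\in\mathcal M$ and runs through epochs $s=1,2,\dots$. In epoch $s$ put $\omega_0^s=\tilde\omega^{s-1}$ and $V_0^s=\operatorname{grad}f(\omega_0^s)$; put $\omega_{t+1}^s=R_{\omega_t^s}(-\alpha_t^sV_t^s)$ for $0\le t<m$, and $\tilde\omega^s=\omega_m^s$. For $1\le t<m$ put $c_t^s=\langle\mathcal T_{\omega_{t-1}^s}^{\omega_t^s}(V_{t-1}^s-\operatorname{grad}f(\omega_{t-1}^s)),\operatorname{grad}f(\omega_t^s)\rangle$, let $\tilde\psi_t^s=\min\{\psi_t^s,\ \mu\|\operatorname{grad}f(\omega_t^s)\|^2/|c_t^s|\}$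 if $c_t^s\ne0$ and $\tilde\psi_t^s=\psi_t^s$ otherwise, and $$\begin{aligned}V_t^s={}&\phi_t^s\Big(\operatorname{grad}f_{I_t^s}(\omega_t^s)-\mathcal T_{\omega_0^s}^{\omega_t^s}\big(\operatorname{grad}f_{I_t^s}(\omega_0^s)-\operatorname{grad}f(\omega_0^s)\big)\Big)\\&+\tilde\psi_t^s\Big(\operatorname{grad}f_{I_t^s}(\omega_t^s)-\mathcal T_{\omega_{t-1}^s}^{\omega_t^s}\big(\operatorname{grad}f_{I_t^s}(\omega_{t-1}^s)-V_{t-1}^s\big)\Big)+(1-\phi_t^s-\tilde\psi_t^s)\operatorname{grad}f_{I_t^s}(\omega_t^s).\end{aligned}$$ Here $\mathcal T_{\omega_{t-1}^s}^{\omega_t^s}=\mathcal T_{-\alpha_{t-1}^sV_{t-1}^s}$, and $\mathcal T_{\omega_0^s}^{\omega_t^s}=\mathcal T_\xi$ for the $\xi\in T_{\omega_0^s}\mathcal M$ with $\|\xi\|<\rho$ and $R_{\omega_0^s}(\xi)=\omega_t^s$, where $\rho>0$ is the number in the next assumption. Assume that there are a point $\omega^*\in\mathcal M$, a compact neighbourhood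 $\Omega$ of $\omega^*$ and a $\rho>0$ such that for every $\omega\in\Omega$ the map $R_\omega$ is a diffeomorphism of the ball $B(0_\omega,\rho)\subset T_\omega\mathcal M$ onto its open image, which contains $\Omega$, and that almost surely $R_{\omega_t^s}(-\tau\alpha_t^sV_t^s)\in\Omega$ for all $s\ge1$, $0\le t<m$ and $\tau\in[0,1]$. If $f\ge0$, then, along the iterates $\omega_0^1,\dots,\omega_{m-1}^1,\omega_0^2,\dots,\omega_{m-1}^2,\dots$, almost surely $\operatorname{grad}f(\omega_t^s)\to0$ (that is, $\|\operatorname{grad}f(\omega_t^s)\|\to0$), and $f(\omega_t^s)$ converges almost surely to a finite random variable. -/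

import Mathlib

open Bundle Manifold MeasureTheory ProbabilityTheory Filter
open scoped ContDiff Topology

noncomputable section

namespace RSHG

/-! Throughout, `M` is a smooth manifold without boundary, modelled on a finite-dimensional real
vector space `E`, and each tangent space carries the inner product of a Riemannian metric. -/

variable {E : Type*} [NormedAddCommGroup E] [NormedSpace ℝ E] [FiniteDimensional ℝ E]
  {M : Type*} [TopologicalSpace M] [ChartedSpace E M] [IsManifold 𝓘(ℝ, E) ∞ M]
  [RiemannianBundle (fun x : M => TangentSpace 𝓘(ℝ, E) x)]

/-- The tangent spaces are complete for the Riemannian norm. -/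
theorem completeSpace_tangentSpace (x : M) : CompleteSpace (TangentSpace 𝓘(ℝ, E) x) := by
  have : FiniteDimensional ℝ (TangentSpace 𝓘(ℝ, E) x) :=
    inferInstanceAs (FiniteDimensional ℝ E)
  exact FiniteDimensional.complete ℝ (TangentSpace 𝓘(ℝ, E) x)

/-- The Riemannian gradient: the vector of `T_x M` that represents the differential of `f` at `x`
with respect to the Riemannian inner product. -/
def grad (f : M → ℝ) (x : M) : TangentSpace 𝓘(ℝ, E) x :=
  haveI := completeSpace_tangentSpace (E := E) x
  (InnerProductSpace.toDual ℝ (TangentSpace 𝓘(ℝ, E) x)).symm (mfderiv 𝓘(ℝ, E) 𝓘(ℝ, ℝ) f x)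

/-- The defining property of the gradient, `⟪grad f (x), ξ⟫ = D f (x) [ξ]`. -/
theorem inner_grad (f : M → ℝ) (x : M) (ξ : TangentSpace 𝓘(ℝ, E) x) :
    inner ℝ (grad f x) ξ = (mfderiv 𝓘(ℝ, E) 𝓘(ℝ, ℝ) f x ξ : ℝ) := by
  have := completeSpace_tangentSpace (E := E) x
  exact InnerProductSpace.toDual_symm_apply

/-- The finite-sum objective `f = (1/n) ∑ᵢ fᵢ`. -/
def objective {n : ℕ} (fs : Fin n → M → ℝ) (x : M) : ℝ :=
  (1 / (n : ℝ)) * ∑ i, fs i x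

/-- The mini-batch gradient `grad f_J (x) = (1/|J|) ∑_{i ∈ J} grad fᵢ (x)`. -/
def batchGrad {n : ℕ} (fs : Fin n → M → ℝ) (J : Finset (Fin n)) (x : M) :
    TangentSpace 𝓘(ℝ, E) x :=
  (1 / (J.card : ℝ)) • ∑ i ∈ J, grad (fs i) x

/-- A retraction: a smooth map `R : TM → M` with `R_x(0) = x` and `D R_x(0)[ξ] = ξ`. The second
condition is stated through the tangent map of `R_x : T_x M → M`, which has to send the tangent
vector `ξ` at `0` to the tangent vector `ξ` at `x`. -/
structure IsRetraction (R : TangentBundle 𝓘(ℝ, E) M → M) : Prop where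
  smooth : ContMDiff (𝓘(ℝ, E)).tangent 𝓘(ℝ, E) ∞ R
  map_zero : ∀ x : M, R ⟨x, 0⟩ = x
  tangentMap_zero : ∀ (x : M) (ξ : TangentSpace 𝓘(ℝ, E) x),
    tangentMap 𝓘(ℝ, TangentSpace 𝓘(ℝ, E) x) 𝓘(ℝ, E)
      (fun v : TangentSpace 𝓘(ℝ, E) x => R ⟨x, v⟩) ⟨0, ξ⟩ = ⟨x, ξ⟩

/-- A vector transport with associated retraction `R`: a family of linear maps
`T_η : T_x M → T_{R_x(η)} M`, `η ∈ T_x M`, which is smooth as a map from the Whitney sum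
`TM ⊕ TM` to `TM`, and such that `T_0` is the identity. Linearity is part of the type of `T`. -/
structure IsVectorTransport (R : TangentBundle 𝓘(ℝ, E) M → M)
    (T : ∀ (x : M) (η : TangentSpace 𝓘(ℝ, E) x),
      TangentSpace 𝓘(ℝ, E) x →ₗ[ℝ] TangentSpace 𝓘(ℝ, E) (R ⟨x, η⟩)) : Prop where
  smooth : ContMDiff (𝓘(ℝ, E).prod 𝓘(ℝ, E × E)) (𝓘(ℝ, E)).tangent ∞
    (fun p : TotalSpace (E × E)
        ((fun x : M => TangentSpace 𝓘(ℝ, E) x) ×ᵇ (fun x : M => TangentSpace 𝓘(ℝ, E) x)) =>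
      (⟨R ⟨p.1, p.2.1⟩, T p.1 p.2.1 p.2.2⟩ : TangentBundle 𝓘(ℝ, E) M))
  map_zero : ∀ (x : M) (ξ : TangentSpace 𝓘(ℝ, E) x),
    (⟨R ⟨x, 0⟩, T x 0 ξ⟩ : TangentBundle 𝓘(ℝ, E) M) = ⟨x, ξ⟩

/-- The vector transport is isometric. -/
def IsIsometricTransport (R : TangentBundle 𝓘(ℝ, E) M → M)
    (T : ∀ (x : M) (η : TangentSpace 𝓘(ℝ, E) x),
      TangentSpace 𝓘(ℝ, E) x →ₗ[ℝ] TangentSpace 𝓘(ℝ, E) (R ⟨x, η⟩)) : Prop :=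
  ∀ (x : M) (η ξ ζ : TangentSpace 𝓘(ℝ, E) x),
    inner ℝ (T x η ξ) (T x η ζ) = (inner ℝ ξ ζ : ℝ)

/-- `Ω` is `ρ`-totally retractive: for every `x ∈ Ω`, the map `R_x` is a diffeomorphism of the open
ball `B(0, ρ)` of `T_x M` onto an open subset of `M`, and this subset contains `Ω`. -/
def IsTotallyRetractive (R : TangentBundle 𝓘(ℝ, E) M → M) (ρ : ℝ) (Ω : Set M) : Prop :=
  ∀ x ∈ Ω,
    (Ω ⊆ (fun v : TangentSpace 𝓘(ℝ, E) x => R ⟨x, v⟩) '' Metric.ball 0 ρ) ∧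
    ∃ Φ : PartialDiffeomorph 𝓘(ℝ, TangentSpace 𝓘(ℝ, E) x) 𝓘(ℝ, E)
        (TangentSpace 𝓘(ℝ, E) x) M ∞,
      Φ.source = Metric.ball 0 ρ ∧
      Set.EqOn (fun v => Φ v) (fun v => R ⟨x, v⟩) (Metric.ball 0 ρ)

open Classical in
/-- The transport `T_x^y : T_x M → T_y M` between two points: this is `T_ξ` for the vector
`ξ = R_x⁻¹(y)` of the ball `B(0, ρ)` of `T_x M` (unique when `x` and `y` lie in a `ρ`-totally
retractive set). The value is `0` if there is no such vector. -/
def transportTo (R : TangentBundle 𝓘(ℝ, E) M → M)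
    (T : ∀ (x : M) (η : TangentSpace 𝓘(ℝ, E) x),
      TangentSpace 𝓘(ℝ, E) x →ₗ[ℝ] TangentSpace 𝓘(ℝ, E) (R ⟨x, η⟩))
    (ρ : ℝ) (x y : M) : TangentSpace 𝓘(ℝ, E) x →ₗ[ℝ] TangentSpace 𝓘(ℝ, E) y :=
  if h : ∃ ξ : TangentSpace 𝓘(ℝ, E) x, ‖ξ‖ < ρ ∧ R ⟨x, ξ⟩ = y then
    h.choose_spec.2 ▸ T x h.choose
  else 0

/-- The input of the algorithm: retraction, vector transport, radius `ρ` of the balls on which the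
retraction is inverted, component functions, step sizes `α`, parameters `φ`, `ψ`, `μ`, inner loop
length `m` and starting point. Epochs are counted from `0`. -/
structure Input (E : Type*) [NormedAddCommGroup E] [NormedSpace ℝ E]
    (M : Type*) [TopologicalSpace M] [ChartedSpace E M] [IsManifold 𝓘(ℝ, E) ∞ M] (n : ℕ) where
  R : TangentBundle 𝓘(ℝ, E) M → M
  T : ∀ (x : M) (η : TangentSpace 𝓘(ℝ, E) x),
    TangentSpace 𝓘(ℝ, E) x →ₗ[ℝ] TangentSpace 𝓘(ℝ, E) (R ⟨x, η⟩)
  ρ : ℝ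
  fs : Fin n → M → ℝ
  α : ℕ → ℕ → ℝ
  φ : ℕ → ℕ → ℝ
  ψ : ℕ → ℕ → ℝ
  μ : ℝ
  m : ℕ
  start : M

namespace Input

variable {n : ℕ} (A : Input E M n)

/-- The objective `f`. -/
def f : M → ℝ := objective A.fs

/-- The point `R_x(-a V)` reached from the pair `p = (x, V)` with step size `a`. -/
def move (a : ℝ) (p : TangentBundle 𝓘(ℝ, E) M) : M := A.R ⟨p.1, -(a • p.2)⟩

/-- The transport `T_x^y = T_{-a V}` from `x` to `y = R_x(-a V)`, where `p = (x, V)`. -/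
def moveTransport (a : ℝ) (p : TangentBundle 𝓘(ℝ, E) M) :
    TangentSpace 𝓘(ℝ, E) p.1 →ₗ[ℝ] TangentSpace 𝓘(ℝ, E) (A.move a p) :=
  A.T p.1 (-(a • p.2))

/-- The number `⟪T_x^y (V - grad f (x)), grad f (y)⟫`, where `p = (x, V)` and `y = R_x(-a V)`. -/
def bias (a : ℝ) (p : TangentBundle 𝓘(ℝ, E) M) : ℝ :=
  inner ℝ (A.moveTransport a p (p.2 - grad A.f p.1)) (grad A.f (A.move a p))

open Classical in
/-- The adapted parameter `ψ̃`. -/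
def adaptedPsi (a ψ : ℝ) (p : TangentBundle 𝓘(ℝ, E) M) : ℝ :=
  if A.bias a p ≠ 0 then
    min ψ (A.μ * ‖grad (E := E) A.f (A.move a p)‖ ^ 2 / |A.bias a p|)
  else ψ

/-- The new descent direction at `y = R_x(-a V)`, where `p = (x, V)` is the previous iterate with
its direction, `x₀` is the first point of the epoch and `J` is the batch that was drawn. -/
def direction (a φ ψ : ℝ) (J : Finset (Fin n)) (x₀ : M) (p : TangentBundle 𝓘(ℝ, E) M) :
    TangentSpace 𝓘(ℝ, E) (A.move a p) :=
  φ • (batchGrad A.fs J (A.move a p)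
      - transportTo A.R A.T A.ρ x₀ (A.move a p) (batchGrad A.fs J x₀ - grad A.f x₀))
    + A.adaptedPsi a ψ p • (batchGrad A.fs J (A.move a p)
      - A.moveTransport a p (batchGrad A.fs J p.1 - p.2))
    + (1 - φ - A.adaptedPsi a ψ p) • batchGrad A.fs J (A.move a p)

/-- The inner loop of epoch `s` started at `x₀`, for the batches `J`: after `t` steps the state is
the pair of the iterate and its descent direction. -/
def innerLoop (J : ℕ → ℕ → Finset (Fin n)) (s : ℕ) (x₀ : M) : ℕ → TangentBundle 𝓘(ℝ, E) M
  | 0 => ⟨x₀, grad A.f x₀⟩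
  | t + 1 => ⟨A.move (A.α s t) (innerLoop J s x₀ t),
      A.direction (A.α s t) (A.φ s (t + 1)) (A.ψ s (t + 1)) (J s (t + 1)) x₀ (innerLoop J s x₀ t)⟩

/-- The first point of epoch `s`: the prescribed starting point for `s = 0`, and otherwise the
point reached after the `m` moves of the preceding epoch. -/
def snapshot (J : ℕ → ℕ → Finset (Fin n)) : ℕ → M
  | 0 => A.start
  | s + 1 => A.move (A.α s (A.m - 1)) (A.innerLoop J s (snapshot J s) (A.m - 1))

/-- The pair of iterate and descent direction at step `t < m` of epoch `s`. -/
def state (J : ℕ → ℕ → Finset (Fin n)) (s t : ℕ) : TangentBundle 𝓘(ℝ, E) M :=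
  A.innerLoop J s (A.snapshot J s) t

/-- All iterates in the order in which the algorithm produces them: the `k`-th one belongs to
step `k % m` of epoch `k / m`. -/
def iterate (J : ℕ → ℕ → Finset (Fin n)) (k : ℕ) : M :=
  (A.state J (k / A.m) (k % A.m)).1

/-- Requirements on the numerical inputs: `m > 0`, `0 < μ < 1`, positive step sizes, and
non-negative `φ`, `ψ` with `φ + ψ ≤ 1`. -/
structure Admissible : Prop where
  m_pos : 0 < A.m
  μ_pos : 0 < A.μ
  μ_lt_one : A.μ < 1
  α_pos : ∀ s, ∀ t < A.m, 0 < A.α s t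
  φ_nonneg : ∀ s t, 1 ≤ t → t < A.m → 0 ≤ A.φ s t
  ψ_nonneg : ∀ s t, 1 ≤ t → t < A.m → 0 ≤ A.ψ s t
  add_le_one : ∀ s t, 1 ≤ t → t < A.m → A.ψ s t + A.φ s t ≤ 1

/-- Decaying step sizes: their sum diverges and the sum of their squares converges. -/
structure DecayingSteps : Prop where
  sum_diverges :
    Tendsto (fun S : ℕ => ∑ s ∈ Finset.range S, ∑ t ∈ Finset.range A.m, A.α s t) atTop atTop
  sum_sq_summable : Summable (fun s : ℕ => ∑ t ∈ Finset.range A.m, A.α s t ^ 2)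

end Input

/-- The random batches `B s t`, `1 ≤ t < m`: they are independent random subsets of the index set,
and `B s t` is uniformly distributed on the subsets with `b s t` elements. -/
structure IsUniformSampling {Ξ : Type*} [MeasurableSpace Ξ] (P : Measure Ξ) {n : ℕ} (m : ℕ)
    (b : ℕ → ℕ → ℕ) (B : ℕ → ℕ → Ξ → Finset (Fin n)) : Prop where
  one_le_card : ∀ s t, 1 ≤ t → t < m → 1 ≤ b s t
  card_le : ∀ s t, 1 ≤ t → t < m → b s t ≤ n
  measurable : ∀ s t, 1 ≤ t → t < m → Measurable (B s t)
  indep : iIndepFun (fun p : {p : ℕ × ℕ // 1 ≤ p.2 ∧ p.2 < m} => B p.1.1 p.1.2) P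
  uniform : ∀ s t, 1 ≤ t → t < m → ∀ J : Finset (Fin n), J.card = b s t →
    P {x | B s t x = J} = ((n.choose (b s t) : ℕ) : ENNReal)⁻¹

end RSHG

end

noncomputable section

namespace RSHG

/-! Let `G = ‖grad f‖²` along the iterates and `W = ⟪V, grad f⟫`. Batch means are unbiased, so given
the past the correction at the first point of the epoch averages out and `V_t` has mean `grad f(ω_t)
+ ψ̃ 𝒯(V_{t-1} - grad f(ω_{t-1}))`. The cap in `ψ̃` makes the second term cost at most `μ ‖grad
f(ω_t)‖²`, hence `W` has conditional mean at least `(1 - μ) G` (`le_sum_inner_direction`).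

Isometry of the transport gives `‖V_t‖ ≤ 3 L + ‖V_{t-1}‖`, where `L` bounds the gradients on `Ω`. As
`V` is reset at each epoch, it is bounded by a constant depending on `m` and `L`. Expanding `f ∘ R`
at the zero section, uniformly over `Ω`, yields `f_{k+1} ≤ f_k - α_k W_k + O(α_k²)` and `|G_{k+1} -
G_k| = O(α_k)`.

Since `∑ α² < ∞`, adding to `f_k` the accumulated decrease and the tail of the error gives a
nonnegative supermartingale (`ae_tendsto_of_descent`). Its convergence gives that of `f_k` and `∑
α_k G_k < ∞`. With `∑ α_k = ∞` and the bound on the increments, `G_k → 0`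
(`tendsto_zero_of_summable_mul`). -/

/-! ### Convergence of real sequences and of supermartingales -/

/-- If `∑ a = ∞`, `∑ a G < ∞` and the increments of `G ≥ 0` are `O(a)`, then `G → 0`. -/
theorem tendsto_zero_of_summable_mul {a G : ℕ → ℝ} {D : ℝ} (ha : ∀ k, 0 ≤ a k)
    (hG : ∀ k, 0 ≤ G k) (hns : ¬ Summable a) (hs : Summable fun k => a k * G k)
    (hinc : ∀ k, |G (k + 1) - G k| ≤ D * a k) : Tendsto G atTop (𝓝 0) := by
  have hD : ∀ k, |G (k + 1) - G k| ≤ (|D| + 1) * a k := fun k =>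
    (hinc k).trans (mul_le_mul_of_nonneg_right ((le_abs_self D).trans (by linarith)) (ha k))
  have hD0 : 0 < |D| + 1 := by positivity
  rw [Metric.tendsto_atTop]
  intro ε' hε'
  set ε := ε' / 2 with hε_def
  have hε : 0 < ε := by positivity
  -- Otherwise `G ≥ ε` from `k` on, and `a ≤ ε⁻¹ a G` would be summable.
  have hfreq : ∀ k, ∃ j, k ≤ j ∧ G j < ε := by
    intro k
    by_contra! h
    apply hns
    rw [← summable_nat_add_iff k]
    have h2 := ((summable_nat_add_iff k).2 hs).mul_left ε⁻¹
    refine Summable.of_nonneg_of_le (fun j => ha _) (fun j => ?_) h2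
    have := h (j + k) (by omega)
    rw [inv_mul_eq_div, le_div_iff₀ hε]
    exact mul_le_mul_of_nonneg_left this (ha _)
  have hδ : 0 < ε ^ 2 / (|D| + 1) := by positivity
  obtain ⟨N, hN⟩ := (Metric.cauchySeq_iff.1 hs.hasSum.tendsto_sum_nat.cauchySeq) _ hδ
  refine ⟨N, fun k hk => ?_⟩
  rw [Real.dist_eq, sub_zero, abs_of_nonneg (hG k)]
  by_contra! hbig
  -- Let `j` be the first index from `k` on with `G j < ε`. Falling from `2 ε` to `ε` requires `(|D|
  -- + 1) ∑ a ≥ ε` over `[k, j)`. There `G ≥ ε`, so `∑ a G ≥ ε² / (|D| + 1)`, against the Cauchy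
  -- criterion.
  obtain ⟨hj1, hj2⟩ := Nat.find_spec (hfreq k)
  set j := Nat.find (hfreq k) with hj
  have hmin : ∀ i ∈ Finset.Ico k j, ε ≤ G i := by
    intro i hi
    by_contra! h
    exact Nat.find_min (hfreq k) (Finset.mem_Ico.1 hi).2 ⟨(Finset.mem_Ico.1 hi).1, h⟩
  have h1 : G k - G j ≤ ∑ i ∈ Finset.Ico k j, (|D| + 1) * a i := by
    have : G k - G j = ∑ i ∈ Finset.Ico k j, (G i - G (i + 1)) := by
      have := Finset.sum_Ico_sub G hj1
      rw [← neg_sub (G j), ← this, ← Finset.sum_neg_distrib]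
      simp
    rw [this]
    refine Finset.sum_le_sum fun i _ => ?_
    have := (abs_le.1 (hD i)).1
    linarith
  have h2 : ε * ∑ i ∈ Finset.Ico k j, (|D| + 1) * a i
      ≤ (|D| + 1) * ∑ i ∈ Finset.Ico k j, a i * G i := by
    rw [Finset.mul_sum, Finset.mul_sum]
    refine Finset.sum_le_sum fun i hi => ?_
    have := mul_le_mul_of_nonneg_left (hmin i hi) (mul_nonneg hD0.le (ha i))
    linarith
  have h3 : ∑ i ∈ Finset.Ico k j, a i * G i < ε ^ 2 / (|D| + 1) := by
    rw [Finset.sum_Ico_eq_sub _ hj1]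
    have := hN j (hk.trans hj1) k hk
    rw [Real.dist_eq] at this
    exact (le_abs_self _).trans_lt this
  rw [lt_div_iff₀ hD0] at h3
  have h4 : ε ≤ G k - G j := by linarith
  nlinarith

/-- Split over the finitely many values of `B`: the factor `w J` is known given `m`, and the
indicator of `B = J` is independent of `m`, so it averages to its probability. -/
theorem condExp_apply_of_indep {Ξ β : Type*} {m m0 : MeasurableSpace Ξ} (hm : m ≤ m0)
    {P : Measure[m0] Ξ} [IsProbabilityMeasure P] [Fintype β] [MeasurableSpace β]
    [MeasurableSingletonClass β] {B : Ξ → β} (hB : Measurable[m0] B)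
    (hind : Indep (MeasurableSpace.comap B inferInstance) m P)
    {w : β → Ξ → ℝ} (hw : ∀ J, StronglyMeasurable[m] (w J)) (hint : ∀ J, Integrable (w J) P) :
    P[fun x => w (B x) x | m] =ᵐ[P] fun x => ∑ J, P.real (B ⁻¹' {J}) * w J x := by
  classical
  have hset : ∀ J, MeasurableSet[m0] (B ⁻¹' {J}) := fun J => hB (measurableSet_singleton J)
  have hprod : ∀ J, Integrable (w J * (B ⁻¹' {J}).indicator fun _ => (1 : ℝ)) P := by
    intro J
    have : (w J * (B ⁻¹' {J}).indicator fun _ => (1 : ℝ)) = (B ⁻¹' {J}).indicator (w J) := by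
      ext x; simp [Set.indicator_apply]
    rw [this]
    exact (hint J).indicator (hset J)
  have h1 : (fun x => w (B x) x) =
      ∑ J, (w J * (B ⁻¹' {J}).indicator fun _ => (1 : ℝ)) := by
    ext x
    simp [Finset.sum_apply, Set.indicator_apply]
  rw [h1]
  have h2 : ∀ J, P[w J * (B ⁻¹' {J}).indicator fun _ => (1 : ℝ) | m] =ᵐ[P]
      fun x => P.real (B ⁻¹' {J}) * w J x := by
    intro J
    have h3 := condExp_mul_of_stronglyMeasurable_left (hw J) (hprod J)
      ((integrable_const (1 : ℝ)).indicator (hset J))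
    have h4 : P[(B ⁻¹' {J}).indicator fun _ => (1 : ℝ) | m] =ᵐ[P]
        fun _ => P[(B ⁻¹' {J}).indicator fun _ => (1 : ℝ)] :=
      condExp_indep_eq hB.comap_le hm
        (stronglyMeasurable_const.indicator ⟨{J}, measurableSet_singleton J, rfl⟩) hind
    filter_upwards [h3, h4] with x hx hx'
    rw [hx, Pi.mul_apply, hx', integral_indicator_const _ (hset J)]
    simp [mul_comm]
  refine (condExp_finsetSum (fun J _ => hprod J) m).trans ?_
  have h5 : ∀ᵐ x ∂P, ∀ J, (P[w J * (B ⁻¹' {J}).indicator fun _ => (1 : ℝ) | m]) x =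
      P.real (B ⁻¹' {J}) * w J x := ae_all_iff.2 h2
  filter_upwards [h5] with x hx
  simp [Finset.sum_apply, hx]

/-- Almost sure convergence of a nonnegative process `f` that decreases at the rate `a * W` up to
an error `C * a ^ 2`, where `W` dominates `c * G` in conditional mean. -/
theorem ae_tendsto_of_descent {Ξ : Type*} {m0 : MeasurableSpace Ξ} {P : Measure Ξ}
    [IsProbabilityMeasure P] {ℱ : Filtration ℕ m0} {f G W : ℕ → Ξ → ℝ} {a : ℕ → ℝ} {c C D : ℝ}
    (hc : 0 < c) (hC : 0 ≤ C) (ha : ∀ k, 0 ≤ a k) (hns : ¬ Summable a)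
    (hsq : Summable fun k => a k ^ 2)
    (hfm : StronglyAdapted ℱ f) (hGm : StronglyAdapted ℱ G)
    (hfi : ∀ k, Integrable (f k) P) (hGi : ∀ k, Integrable (G k) P)
    (hWi : ∀ k, Integrable (W k) P) (hf0 : ∀ k x, 0 ≤ f k x) (hG0 : ∀ k x, 0 ≤ G k x)
    (hdesc : ∀ k, ∀ᵐ x ∂P, f (k + 1) x ≤ f k x - a k * W k x + C * a k ^ 2)
    (hcond : ∀ k, (fun x => c * G k x) ≤ᵐ[P] P[W k | ℱ k])
    (hinc : ∀ k, ∀ᵐ x ∂P, |G (k + 1) x - G k x| ≤ D * a k) :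
    (∀ᵐ x ∂P, Tendsto (fun k => G k x) atTop (𝓝 0)) ∧
      ∃ X : Ξ → ℝ, Measurable X ∧ ∀ᵐ x ∂P, Tendsto (fun k => f k x) atTop (𝓝 (X x)) := by
  have hsqC : Summable fun k => C * a k ^ 2 := hsq.mul_left C
  set S := ∑' k, C * a k ^ 2 with hS
  -- The tail of `∑ C a²` pays for the error of each step and keeps `Y` nonnegative.
  let Y : ℕ → Ξ → ℝ := fun k => f k + (fun x => ∑ j ∈ Finset.range k, c * a j * G j x)
    + fun _ => (S - ∑ j ∈ Finset.range k, C * a j ^ 2)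
  have hYapp : ∀ k x, Y k x = f k x + ∑ j ∈ Finset.range k, c * a j * G j x
    + (S - ∑ j ∈ Finset.range k, C * a j ^ 2) := fun k x => rfl
  have hrest : ∀ k, 0 ≤ S - ∑ j ∈ Finset.range k, C * a j ^ 2 := fun k =>
    sub_nonneg.2 (hsqC.sum_le_tsum _ (fun j _ => by positivity))
  have hsum0 : ∀ k x, 0 ≤ ∑ j ∈ Finset.range k, c * a j * G j x := fun k x =>
    Finset.sum_nonneg fun j _ => mul_nonneg (mul_nonneg hc.le (ha j)) (hG0 j x)
  have hY0 : ∀ k x, 0 ≤ Y k x := fun k x => by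
    rw [hYapp]; linarith [hf0 k x, hsum0 k x, hrest k]
  have hsumm : ∀ k, StronglyMeasurable[ℱ k]
      (fun x => ∑ j ∈ Finset.range k, c * a j * G j x) := by
    intro k
    refine Finset.stronglyMeasurable_fun_sum _ fun j hj => ?_
    exact ((hGm j).mono (ℱ.mono (Finset.mem_range.1 hj).le)).const_mul _
  have hYm : StronglyAdapted ℱ Y := fun k =>
    ((hfm k).add (hsumm k)).add stronglyMeasurable_const
  have hYi : ∀ k, Integrable (Y k) P := fun k =>
    ((hfi k).add (integrable_finsetSum _ fun j _ => (hGi j).const_mul _)).add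
      (integrable_const _)
  have hsuper : Supermartingale Y ℱ P := by
    refine supermartingale_nat hYm hYi fun k => ?_
    have hUm : StronglyMeasurable[ℱ k] (Y k + fun x => c * a k * G k x) :=
      (hYm k).add ((hGm k).const_mul _)
    have hUi : Integrable (Y k + fun x => c * a k * G k x) P :=
      (hYi k).add ((hGi k).const_mul _)
    have hle : Y (k + 1) ≤ᵐ[P] (Y k + fun x => c * a k * G k x) - a k • W k := by
      filter_upwards [hdesc k] with x hx
      simp only [Pi.sub_apply, Pi.add_apply, Pi.smul_apply, smul_eq_mul, hYapp,
        Finset.sum_range_succ]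
      linarith
    have h1 := condExp_mono (m := ℱ k) (hYi (k + 1)) (hUi.sub ((hWi k).smul (a k))) hle
    have h2 := condExp_sub hUi ((hWi k).smul (a k)) (ℱ k)
    have h3 := condExp_smul (μ := P) (a k) (W k) (ℱ k)
    have h4 := condExp_of_stronglyMeasurable (μ := P) (ℱ.le k) hUm hUi
    rw [h4] at h2
    filter_upwards [h1, h2, h3, hcond k] with x h1 h2 h3 h5
    rw [h2] at h1
    simp only [Pi.sub_apply, Pi.add_apply] at h1
    rw [h3] at h1
    simp only [Pi.smul_apply, smul_eq_mul] at h1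
    have := mul_le_mul_of_nonneg_left h5 (ha k)
    linarith
  -- For `Y ≥ 0` the `L¹` norm is the mean, which a supermartingale does not increase.
  have hbdd : ∀ k, eLpNorm ((-Y) k) 1 P ≤ ((∫ x, Y 0 x ∂P).toNNReal : ENNReal) := by
    intro k
    rw [Pi.neg_apply, eLpNorm_neg, eLpNorm_one_eq_lintegral_enorm]
    have : ∫⁻ x, ‖Y k x‖ₑ ∂P = ENNReal.ofReal (∫ x, Y k x ∂P) := by
      rw [ofReal_integral_eq_lintegral_ofReal (hYi k) (Eventually.of_forall (hY0 k))]
      refine lintegral_congr fun x => ?_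
      rw [Real.enorm_eq_ofReal (hY0 k x)]
    rw [this]
    refine ENNReal.ofReal_le_ofReal ?_
    have := hsuper.setIntegral_le (Nat.zero_le k) MeasurableSet.univ
    simpa using this
  have hconv := hsuper.neg.exists_ae_tendsto_of_bdd hbdd
  have hmain : ∀ᵐ x ∂P, (Summable fun k => a k * G k x) ∧
      ∃ l, Tendsto (fun k => f k x) atTop (𝓝 l) := by
    filter_upwards [hconv] with x hx
    obtain ⟨l, hl⟩ := hx
    have hl' : Tendsto (fun k => Y k x) atTop (𝓝 (-l)) := by simpa using hl.neg
    obtain ⟨K, hK⟩ := hl'.bddAbove_range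
    have hsumc : Summable fun k => c * a k * G k x := by
      refine summable_of_sum_range_le (c := K)
        (fun j => mul_nonneg (mul_nonneg hc.le (ha j)) (hG0 j x)) fun k => ?_
      have : Y k x ≤ K := hK ⟨k, rfl⟩
      rw [hYapp] at this
      linarith [hf0 k x, hrest k]
    refine ⟨?_, ?_⟩
    · have := hsumc.mul_left c⁻¹
      refine this.congr fun k => ?_
      field_simp
    · have h1 := hsumc.hasSum.tendsto_sum_nat
      have h2 := hsqC.hasSum.tendsto_sum_nat
      have h3 := (hl'.sub h1).sub (h2.const_sub S)
      refine ⟨_, h3.congr fun k => ?_⟩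
      rw [hYapp]; ring
  refine ⟨?_, ?_⟩
  · filter_upwards [hmain, ae_all_iff.2 hinc] with x hx hx'
    exact tendsto_zero_of_summable_mul ha (fun k => hG0 k x) hns hx.1 hx'
  · obtain ⟨X, hX, hlim⟩ := measurable_limit_of_tendsto_metrizable_ae
      (fun k => ((hfm k).mono (ℱ.le k)).measurable.aemeasurable) (hmain.mono fun x hx => hx.2)
    exact ⟨X, hX, hlim⟩

/-! ### Expansions at the zero section of the tangent bundle -/

variable {E : Type*} [NormedAddCommGroup E] [NormedSpace ℝ E] [FiniteDimensional ℝ E]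
  {M : Type*} [TopologicalSpace M] [ChartedSpace E M] [IsManifold 𝓘(ℝ, E) ∞ M]
  [RiemannianBundle (fun x : M => TangentSpace 𝓘(ℝ, E) x)]

/-- The derivative of a `C²` function is locally Lipschitz; the mean value inequality on the segment
from `(p.1, 0)` to `p` then gives one constant for all nearby base points. -/
theorem eventually_abs_taylor_le {E F : Type*} [NormedAddCommGroup E] [NormedSpace ℝ E]
    [NormedAddCommGroup F] [NormedSpace ℝ F] {g : E × F → ℝ} {z : E}
    (hg : ContDiffAt ℝ 2 g (z, 0)) :
    ∃ C : ℝ, ∀ᶠ p in 𝓝 (z, (0 : F)),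
      |g p - g (p.1, 0) - fderiv ℝ g (p.1, 0) (0, p.2)| ≤ C * ‖p.2‖ ^ 2 ∧
        DifferentiableAt ℝ g (p.1, 0) := by
  obtain ⟨K, t, ht, hK⟩ := (hg.fderiv_right (m := 1) (by norm_num)).exists_lipschitzOnWith
  have hd : ∀ᶠ p in 𝓝 (z, (0 : F)), DifferentiableAt ℝ g p :=
    (hg.eventually (by simp)).mono fun p hp => hp.differentiableAt (by norm_num)
  obtain ⟨r, hr, hball⟩ := Metric.mem_nhds_iff.1 (Filter.inter_mem ht hd)
  refine ⟨K, ?_⟩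
  filter_upwards [Metric.ball_mem_nhds _ hr] with p hp
  have hp0 : (p.1, (0 : F)) ∈ Metric.ball (z, (0 : F)) r := by
    rw [Metric.mem_ball, Prod.dist_eq] at hp ⊢
    simp only [max_lt_iff, dist_self] at hp ⊢
    exact ⟨hp.1, hr⟩
  have hseg : segment ℝ (p.1, (0 : F)) p ⊆ Metric.ball (z, (0 : F)) r :=
    (convex_ball _ _).segment_subset hp0 hp
  refine ⟨?_, (hball hp0).2⟩
  have hsub : p - (p.1, (0 : F)) = (0, p.2) := by ext <;> simp
  have hnorm : ‖p - (p.1, (0 : F))‖ = ‖p.2‖ := by rw [hsub]; simp [Prod.norm_def]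
  have := (convex_segment (𝕜 := ℝ) (p.1, (0 : F)) p).norm_image_sub_le_of_norm_hasFDerivWithin_le'
    (f := g) (f' := fderiv ℝ g) (φ := fderiv ℝ g (p.1, 0)) (C := K * ‖p.2‖)
    (fun q hq => (hball (hseg hq)).2.hasFDerivAt.hasFDerivWithinAt)
    (fun q hq => by
      refine (hK.norm_sub_le (hball (hseg hq)).1 (hball hp0).1).trans ?_
      gcongr
      rw [← hnorm, norm_sub_rev]
      rw [norm_sub_rev p]
      obtain ⟨θ, hθ, rfl⟩ := segment_eq_image' ℝ (p.1, (0 : F)) p ▸ hq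
      have : (p.1, (0 : F)) - ((p.1, (0 : F)) + θ • (p - (p.1, (0 : F))))
        = - (θ • (p - (p.1, (0 : F)))) := by abel
      rw [this, norm_neg, norm_smul, norm_sub_rev p, Real.norm_eq_abs, abs_of_nonneg hθ.1]
      exact mul_le_of_le_one_left (norm_nonneg _) hθ.2)
    (left_mem_segment ℝ _ _) (right_mem_segment ℝ _ _)
  rw [hnorm, hsub, Real.norm_eq_abs] at this
  linarith

/-- The expression of a function on the tangent bundle in the chart at a zero vector. -/
theorem coordinates_tangentBundle (x₀ x : M) (hx : x ∈ (chartAt E x₀).source)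
    (η : TangentSpace 𝓘(ℝ, E) x) :
    (extChartAt (𝓘(ℝ, E)).tangent (⟨x₀, 0⟩ : TangentBundle 𝓘(ℝ, E) M)).symm
      (extChartAt 𝓘(ℝ, E) x₀ x,
        (trivializationAt E (TangentSpace 𝓘(ℝ, E)) x₀).continuousLinearMapAt ℝ x η)
      = ⟨x, η⟩ := by
  have h := (extChartAt (𝓘(ℝ, E)).tangent (⟨x₀, 0⟩ : TangentBundle 𝓘(ℝ, E) M)).left_inv
    (x := ⟨x, η⟩) (by simpa [extChartAt_source, TangentBundle.mem_chart_source_iff] using hx)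
  have h2 : extChartAt (𝓘(ℝ, E)).tangent (⟨x₀, 0⟩ : TangentBundle 𝓘(ℝ, E) M) ⟨x, η⟩ =
      (extChartAt 𝓘(ℝ, E) x₀ x,
        (trivializationAt E (TangentSpace 𝓘(ℝ, E)) x₀).continuousLinearMapAt ℝ x η) := by
    rw [FiberBundle.extChartAt]
    refine Prod.ext ?_ ?_
    · simp
    · simp only [mfld_simps]
      rw [Bundle.Trivialization.continuousLinearMapAt_apply, Bundle.Trivialization.coe_linearMapAt_of_mem]
      exact hx
  rw [← h2, h]

theorem contDiffAt_coordinates_tangentBundle {F : TangentBundle 𝓘(ℝ, E) M → ℝ} {n : ℕ∞} {x₀ : M}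
    (hF : ContMDiffAt (𝓘(ℝ, E)).tangent 𝓘(ℝ, ℝ) n F ⟨x₀, 0⟩) :
    ContDiffAt ℝ n
      (F ∘ (extChartAt (𝓘(ℝ, E)).tangent (⟨x₀, 0⟩ : TangentBundle 𝓘(ℝ, E) M)).symm)
      (extChartAt 𝓘(ℝ, E) x₀ x₀, 0) := by
  have h := (contMDiffAt_iff.1 hF).2
  have h0 : extChartAt (𝓘(ℝ, E)).tangent (⟨x₀, 0⟩ : TangentBundle 𝓘(ℝ, E) M) ⟨x₀, 0⟩
      = (extChartAt 𝓘(ℝ, E) x₀ x₀, 0) := by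
    rw [FiberBundle.extChartAt]
    refine Prod.ext ?_ ?_
    · simp
    · simp only [mfld_simps]
      have := (trivializationAt E (TangentSpace 𝓘(ℝ, E)) x₀).coe_linearMapAt_of_mem (R := ℝ)
        (b := x₀) (by simp)
      exact (congrFun this 0).symm.trans (map_zero _)
  rw [h0] at h
  rw [ModelWithCorners.range_eq_univ, contDiffWithinAt_univ] at h
  exact h

section Metric

variable [IsContMDiffRiemannianBundle 𝓘(ℝ, E) ∞ E (fun x : M => TangentSpace 𝓘(ℝ, E) x)]

theorem isContinuousRiemannianBundle_tangentSpace :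
    IsContinuousRiemannianBundle E (fun x : M => TangentSpace 𝓘(ℝ, E) x) := by
  obtain ⟨g, hg, h⟩ := IsContMDiffRiemannianBundle.exists_contMDiff (IB := 𝓘(ℝ, E)) (n := ∞)
    (F := E) (E := fun x : M => TangentSpace 𝓘(ℝ, E) x)
  exact ⟨g, hg.continuous, h⟩

/-- A neighbourhood of the zero vector of the model yields a neighbourhood of the zero section. -/
theorem exists_eventually_of_eventually_coordinates {x₀ : M} {p : E × E → Prop}
    (hp : ∀ᶠ q in 𝓝 (extChartAt 𝓘(ℝ, E) x₀ x₀, (0 : E)), p q) :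
    ∃ K > 0, ∃ δ > 0, ∀ᶠ x in 𝓝 x₀, x ∈ (chartAt E x₀).source ∧
      ∀ η : TangentSpace 𝓘(ℝ, E) x,
        ‖(trivializationAt E (TangentSpace 𝓘(ℝ, E)) x₀).continuousLinearMapAt ℝ x η‖ ≤ K * ‖η‖ ∧
        (‖η‖ < δ → p (extChartAt 𝓘(ℝ, E) x₀ x,
          (trivializationAt E (TangentSpace 𝓘(ℝ, E)) x₀).continuousLinearMapAt ℝ x η)) := by
  have := isContinuousRiemannianBundle_tangentSpace (E := E) (M := M)
  obtain ⟨K, hK, hKx⟩ := eventually_norm_trivializationAt_lt E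
    (fun x : M => TangentSpace 𝓘(ℝ, E) x) x₀
  obtain ⟨r, hr, hball⟩ := Metric.eventually_nhds_iff_ball.1 hp
  -- `K` bounds the trivialization near `x₀`, so vectors shorter than `r / K` have coordinates
  -- shorter than `r`.
  refine ⟨K, hK, r / K, by positivity, ?_⟩
  have h1 : ∀ᶠ x in 𝓝 x₀, extChartAt 𝓘(ℝ, E) x₀ x ∈ Metric.ball (extChartAt 𝓘(ℝ, E) x₀ x₀) r :=
    (continuousAt_extChartAt (I := 𝓘(ℝ, E)) x₀) (Metric.ball_mem_nhds _ hr)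
  filter_upwards [hKx, h1, (chartAt E x₀).open_source.mem_nhds (mem_chart_source E x₀)]
    with x hx hx1 hx2
  refine ⟨hx2, fun η => ?_⟩
  have h2 : ‖(trivializationAt E (TangentSpace 𝓘(ℝ, E)) x₀).continuousLinearMapAt ℝ x η‖
      ≤ K * ‖η‖ := (ContinuousLinearMap.le_opNorm _ η).trans (by gcongr)
  refine ⟨h2, fun hη => hball _ ?_⟩
  rw [← ball_prod_same]
  refine ⟨hx1, ?_⟩
  rw [mem_ball_zero_iff]
  refine h2.trans_lt ?_
  rw [lt_div_iff₀ hK] at hη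
  linarith

theorem eventually_abs_sub_zeroSection_le {F : TangentBundle 𝓘(ℝ, E) M → ℝ} {x₀ : M}
    (hF : ContMDiffAt (𝓘(ℝ, E)).tangent 𝓘(ℝ, ℝ) 1 F ⟨x₀, 0⟩) :
    ∃ C, ∃ δ > 0, ∀ᶠ x in 𝓝 x₀, ∀ η : TangentSpace 𝓘(ℝ, E) x, ‖η‖ < δ →
      |F ⟨x, η⟩ - F ⟨x, 0⟩| ≤ C * ‖η‖ := by
  obtain ⟨L, t, ht, hL⟩ := (contDiffAt_coordinates_tangentBundle (n := 1) hF).exists_lipschitzOnWith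
  obtain ⟨K, hK, δ, hδ, h⟩ := exists_eventually_of_eventually_coordinates (M := M) ht
  refine ⟨L * K, δ, hδ, ?_⟩
  filter_upwards [h] with x hx η hη
  have h1 := (hx.2 η).2 hη
  have h0 := (hx.2 0).2 (by simpa using hδ)
  have h2 := hL.norm_sub_le h1 h0
  simp only [Function.comp_apply, coordinates_tangentBundle x₀ x hx.1, Real.norm_eq_abs] at h2
  refine h2.trans ?_
  rw [mul_assoc]
  gcongr
  simpa [Prod.norm_def] using (hx.2 η).1

/-- The linear term enters as a radial derivative `ℓ`, which is free of coordinates and can later be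
identified with `⟪grad f, η⟫`. Since the trivialization is linear on fibres, rays remain rays in
coordinates. -/
theorem eventually_abs_taylor_zeroSection_le {F : TangentBundle 𝓘(ℝ, E) M → ℝ} {x₀ : M}
    (hF : ContMDiffAt (𝓘(ℝ, E)).tangent 𝓘(ℝ, ℝ) 2 F ⟨x₀, 0⟩) :
    ∃ C, ∃ δ > 0, ∀ᶠ x in 𝓝 x₀, ∀ η : TangentSpace 𝓘(ℝ, E) x, ‖η‖ < δ → ∀ ℓ,
      HasDerivAt (fun τ : ℝ => F ⟨x, τ • η⟩) ℓ 0 →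
      |F ⟨x, η⟩ - F ⟨x, 0⟩ - ℓ| ≤ C * ‖η‖ ^ 2 := by
  obtain ⟨C, hC⟩ := eventually_abs_taylor_le (contDiffAt_coordinates_tangentBundle (n := 2) hF)
  obtain ⟨K, hK, δ, hδ, h⟩ := exists_eventually_of_eventually_coordinates (M := M) hC
  refine ⟨|C| * K ^ 2, δ, hδ, ?_⟩
  filter_upwards [h] with x hx η hη ℓ hℓ
  obtain ⟨h1, hd⟩ := (hx.2 η).2 hη
  set g := F ∘ (extChartAt (𝓘(ℝ, E)).tangent (⟨x₀, 0⟩ : TangentBundle 𝓘(ℝ, E) M)).symm with hg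
  set e := (trivializationAt E (TangentSpace 𝓘(ℝ, E)) x₀).continuousLinearMapAt ℝ x with he
  set z := extChartAt 𝓘(ℝ, E) x₀ x
  have hgx : ∀ ζ, g (z, e ζ) = F ⟨x, ζ⟩ := fun ζ =>
    congrArg F (coordinates_tangentBundle x₀ x hx.1 ζ)
  have hder : HasDerivAt (fun τ : ℝ => F ⟨x, τ • η⟩) (fderiv ℝ g (z, 0) (0, e η)) 0 := by
    have h3 : HasDerivAt (fun τ : ℝ => (z, τ • e η)) ((0 : E), e η) 0 := by
      have := (hasDerivAt_const (0 : ℝ) z).prodMk ((hasDerivAt_id (0 : ℝ)).smul_const (e η))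
      simpa using this
    have h4 : HasFDerivAt g (fderiv ℝ g (z, 0)) (z, (0 : ℝ) • e η) := by
      rw [zero_smul]; exact hd.hasFDerivAt
    have h5 := h4.comp_hasDerivAt (0 : ℝ) h3
    refine h5.congr_of_eventuallyEq (Eventually.of_forall fun τ => ?_)
    simp only [Function.comp_apply]
    rw [← map_smul]
    exact (hgx _).symm
  rw [hℓ.unique hder]
  have h0 : g (z, 0) = F ⟨x, 0⟩ := by rw [← hgx 0, map_zero]
  rw [hgx, h0] at h1
  refine h1.trans ?_
  calc C * ‖e η‖ ^ 2 ≤ |C| * (K * ‖η‖) ^ 2 := by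
        gcongr
        · exact le_abs_self C
        · exact (hx.2 η).1
    _ = |C| * K ^ 2 * ‖η‖ ^ 2 := by ring

/-! ### Regularity of the squared gradient norm -/

/-- The metric and a differential in the trivialization of the tangent bundle at `x₀` determine the
squared norm of the gradient. -/
theorem contMDiffAt_norm_sq_grad {f : M → ℝ} {x₀ : M}
    (hf : ContMDiffAt 𝓘(ℝ, E) 𝓘(ℝ, ℝ) 2 f x₀) :
    ContMDiffAt 𝓘(ℝ, E) 𝓘(ℝ, ℝ) 1 (fun x => ‖grad (E := E) f x‖ ^ 2) x₀ := by
  obtain ⟨g, hg, hinner⟩ := IsContMDiffRiemannianBundle.exists_contMDiff (IB := 𝓘(ℝ, E)) (n := ∞)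
    (F := E) (E := fun x : M => TangentSpace 𝓘(ℝ, E) x)
  set e := trivializationAt E (TangentSpace 𝓘(ℝ, E) : M → Type _) x₀ with he
  have hmetric := (contMDiffAt_section x₀).1 (hg x₀)
  set b : M → E →L[ℝ] E →L[ℝ] ℝ := fun x => (trivializationAt (E →L[ℝ] E →L[ℝ] ℝ)
    (fun x : M => TangentSpace 𝓘(ℝ, E) x →L[ℝ] TangentSpace 𝓘(ℝ, E) x →L[ℝ] ℝ) x₀ ⟨x, g x⟩).2
  have hd := hf.mfderiv_const (m := 1) (by norm_num)
  set d : M → E →L[ℝ] ℝ := inTangentCoordinates 𝓘(ℝ, E) 𝓘(ℝ, ℝ) id f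
    (mfderiv 𝓘(ℝ, E) 𝓘(ℝ, ℝ) f) x₀
  have hbapp : ∀ x ∈ e.baseSet, ∀ u v, b x u v = inner ℝ (e.symmL ℝ x u) (e.symmL ℝ x v) := by
    intro x hx u v
    rw [hinner]
    have h := inCoordinates_apply_eq₂ (F₁ := E) (F₂ := E) (F₃ := ℝ)
      (E₁ := fun x : M => TangentSpace 𝓘(ℝ, E) x) (E₂ := fun x : M => TangentSpace 𝓘(ℝ, E) x)
      (E₃ := Bundle.Trivial M ℝ) (x₀ := x₀) (x := x) (ϕ := g x) (v := u) (w := v) hx hx (by simp)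
    rw [e.symmL_apply hx, e.symmL_apply hx]
    refine (show b x u v = _ from h).trans ?_
    simp
    rfl
  have hdapp : ∀ x ∈ e.baseSet, ∀ v, d x v = inner ℝ (grad (E := E) f x) (e.symmL ℝ x v) := by
    intro x hx v
    rw [inner_grad]
    simp only [d, inTangentCoordinates, ContinuousLinearMap.inCoordinates]
    simp
    rfl
  -- Positive definiteness makes the metric injective as a map to the dual, hence invertible in
  -- finite dimension.
  have hequiv : ∀ x ∈ e.baseSet, ∃ L : E ≃L[ℝ] (E →L[ℝ] ℝ), (L : E →L[ℝ] E →L[ℝ] ℝ) = b x := by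
    intro x hx
    have hinj : Function.Injective (b x : E →ₗ[ℝ] (E →L[ℝ] ℝ)) := by
      rw [injective_iff_map_eq_zero]
      intro u hu
      have h1 : b x u u = 0 := by
        have : b x u = 0 := hu
        rw [this]; rfl
      rw [hbapp x hx, inner_self_eq_zero] at h1
      have h2 := e.continuousLinearMapAt_symmL (R := ℝ) hx u
      rw [h1, map_zero] at h2
      exact h2.symm
    have hrank : Module.finrank ℝ E = Module.finrank ℝ (E →L[ℝ] ℝ) := by
      rw [← (LinearMap.toContinuousLinearMap : (E →ₗ[ℝ] ℝ) ≃ₗ[ℝ] _).finrank_eq]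
      exact Subspace.dual_finrank_eq.symm
    refine ⟨(LinearEquiv.ofInjectiveOfFinrankEq _ hinj hrank).toContinuousLinearEquiv, ?_⟩
    ext u v
    rfl
  have hbase : ∀ᶠ x in 𝓝 x₀, x ∈ e.baseSet :=
    e.open_baseSet.mem_nhds (mem_baseSet_trivializationAt E _ x₀)
  have hinv : ContMDiffAt 𝓘(ℝ, E) 𝓘(ℝ, (E →L[ℝ] ℝ) →L[ℝ] E) 1
      (fun x => ContinuousLinearMap.inverse (b x)) x₀ := by
    obtain ⟨L, hL⟩ := hequiv x₀ (mem_baseSet_trivializationAt E _ x₀)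
    have h1 : ContDiffAt ℝ 1 ContinuousLinearMap.inverse (b x₀) := by
      rw [← hL]; exact contDiffAt_map_inverse L
    exact h1.contMDiffAt.comp x₀ (hmetric.of_le (by simp))
  -- With `b` the metric and `d` the differential in coordinates, `‖grad f‖² = d (b⁻¹ d)`; inversion
  -- of operators is smooth.
  have hall : ContMDiffAt 𝓘(ℝ, E) 𝓘(ℝ, ℝ) 1
      (fun x => d x (ContinuousLinearMap.inverse (b x) (d x))) x₀ :=
    hd.clm_apply (hinv.clm_apply hd)
  refine hall.congr_of_eventuallyEq ?_
  filter_upwards [hbase] with x hx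
  obtain ⟨L, hL⟩ := hequiv x hx
  have h1 : b x (e.continuousLinearMapAt ℝ x (grad (E := E) f x)) = d x := by
    ext v
    rw [hbapp x hx, hdapp x hx, e.symmL_continuousLinearMapAt hx]
  rw [← hL, ContinuousLinearMap.inverse_equiv]
  have h2 : L.symm (d x) = e.continuousLinearMapAt ℝ x (grad (E := E) f x) := by
    rw [← h1, ← hL]; simp
  change _ = d x (L.symm (d x))
  rw [h2, hdapp x hx, e.symmL_continuousLinearMapAt hx, real_inner_self_eq_norm_sq]

theorem norm_grad_bounded {f : M → ℝ} (hf : ContMDiff 𝓘(ℝ, E) 𝓘(ℝ, ℝ) 2 f) {Ω : Set M}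
    (hΩ : IsCompact Ω) : ∃ C, ∀ x ∈ Ω, ‖grad (E := E) f x‖ ≤ C := by
  have hc : Continuous fun x => ‖grad (E := E) f x‖ ^ 2 := continuous_iff_continuousAt.2 fun x =>
    (contMDiffAt_norm_sq_grad (hf x)).continuousAt
  obtain ⟨C, hC⟩ := hΩ.exists_bound_of_continuousOn hc.continuousOn
  refine ⟨√C, fun x hx => Real.le_sqrt_of_sq_le ?_⟩
  exact (le_abs_self _).trans (hC x hx)

/-! ### Estimates along the retraction, uniform over a compact set -/

theorem IsRetraction.hasDerivAt {R : TangentBundle 𝓘(ℝ, E) M → M} (hR : IsRetraction R)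
    {f : M → ℝ} {x : M} (hf : MDifferentiableAt 𝓘(ℝ, E) 𝓘(ℝ, ℝ) f x)
    (η : TangentSpace 𝓘(ℝ, E) x) :
    HasDerivAt (fun τ : ℝ => f (R ⟨x, τ • η⟩)) (inner ℝ (grad f x) η) 0 := by
  rcases eq_or_ne η 0 with rfl | hη
  · simpa using hasDerivAt_const (0 : ℝ) (f (R ⟨x, 0⟩))
  set r : TangentSpace 𝓘(ℝ, E) x → M := fun v => R ⟨x, v⟩ with hr
  have hr0 : r 0 = x := hR.map_zero x
  have ht := hR.tangentMap_zero x η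
  -- Where `r` is not differentiable its `mfderiv` is `0` by default, so the tangent map would send
  -- `η ≠ 0` to `0` rather than to `η`.
  have hrd : MDifferentiableAt 𝓘(ℝ, TangentSpace 𝓘(ℝ, E) x) 𝓘(ℝ, E) r 0 := by
    by_contra h
    have h0 : (tangentMap 𝓘(ℝ, TangentSpace 𝓘(ℝ, E) x) 𝓘(ℝ, E) r ⟨0, η⟩) = ⟨r 0, 0⟩ := by
      rw [tangentMap, mfderiv_zero_of_not_mdifferentiableAt h]; rfl
    rw [h0] at ht
    have key : ∀ y : M, y = x → (⟨y, 0⟩ : TangentBundle 𝓘(ℝ, E) M) = ⟨x, η⟩ → η = 0 := by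
      rintro y rfl h
      exact (TotalSpace.mk_inj.1 h).symm
    exact hη (key _ hr0 ht)
  have hf' : MDifferentiableAt 𝓘(ℝ, E) 𝓘(ℝ, ℝ) f (r 0) := by rwa [hr0]
  have hcomp := tangentMap_comp_at (I := 𝓘(ℝ, TangentSpace 𝓘(ℝ, E) x)) (I' := 𝓘(ℝ, E))
    (I'' := 𝓘(ℝ, ℝ)) (g := f) (f := r) ⟨0, η⟩ hf' hrd
  rw [ht] at hcomp
  have hval := congrArg (fun p : TangentBundle 𝓘(ℝ, ℝ) ℝ => (p.2 : ℝ)) hcomp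
  have hfd : DifferentiableAt ℝ (f ∘ r) 0 := (hf'.comp 0 hrd).differentiableAt
  have hfd' : HasFDerivAt (f ∘ r) (fderiv ℝ (f ∘ r) 0) ((0 : ℝ) • η) := by
    rw [zero_smul]; exact hfd.hasFDerivAt
  have hder := hfd'.comp_hasDerivAt (0 : ℝ) ((hasDerivAt_id (0 : ℝ)).smul_const η)
  have heq : fderiv ℝ (f ∘ r) 0 ((1 : ℝ) • η) = inner ℝ (grad f x) η := by
    rw [one_smul, inner_grad, ← mfderiv_eq_fderiv]
    exact hval
  rw [heq] at hder
  exact hder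

/-- Local estimates in terms of small tangent vectors, together with a crude global bound, are
uniform over a compact set. -/
theorem exists_forall_le_mul_norm_pow {Ω : Set M} (hΩ : IsCompact Ω) {k : ℕ} (hk : k ≠ 0)
    {H : ∀ x : M, TangentSpace 𝓘(ℝ, E) x → ℝ} {Q : ∀ x : M, TangentSpace 𝓘(ℝ, E) x → Prop}
    (hloc : ∀ x₀ : M, ∃ C, ∃ δ > 0, ∀ᶠ x in 𝓝 x₀, ∀ η : TangentSpace 𝓘(ℝ, E) x, ‖η‖ < δ →
      H x η ≤ C * ‖η‖ ^ k)
    {D : ℝ} (hD : ∀ x ∈ Ω, ∀ η, Q x η → H x η ≤ D * (1 + ‖η‖)) :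
    ∃ C, 0 ≤ C ∧ ∀ x ∈ Ω, ∀ η, Q x η → H x η ≤ C * ‖η‖ ^ k := by
  obtain ⟨C, δ, hδ, h⟩ : ∃ C, ∃ δ > 0, ∀ x ∈ Ω, ∀ η : TangentSpace 𝓘(ℝ, E) x, ‖η‖ < δ →
      H x η ≤ C * ‖η‖ ^ k := by
    refine hΩ.induction_on ⟨0, 1, one_pos, by simp⟩ ?_ ?_ ?_
    · rintro s t hst ⟨C, δ, hδ, h⟩
      exact ⟨C, δ, hδ, fun x hx => h x (hst hx)⟩
    · rintro s t ⟨C, δ, hδ, h⟩ ⟨C', δ', hδ', h'⟩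
      refine ⟨max C C', min δ δ', lt_min hδ hδ', fun x hx η hη => ?_⟩
      rcases hx with hx | hx
      · exact (h x hx η (hη.trans_le (min_le_left _ _))).trans (by gcongr; exact le_max_left _ _)
      · exact (h' x hx η (hη.trans_le (min_le_right _ _))).trans
          (by gcongr; exact le_max_right _ _)
    · intro x₀ _
      obtain ⟨C, δ, hδ, h⟩ := hloc x₀
      exact ⟨_, mem_nhdsWithin_of_mem_nhds h, C, δ, hδ, fun x hx => hx⟩
  -- The second constant serves long vectors: if `u = ‖η‖ / δ ≥ 1`, then `1 + ‖η‖ ≤ (1 + δ) u ^ k`.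
  refine ⟨max |C| (|D| * ((1 + δ) / δ ^ k)), by positivity, fun x hx η hQ => ?_⟩
  rcases lt_or_ge ‖η‖ δ with hη | hη
  · refine (h x hx η hη).trans ?_
    gcongr
    exact (le_abs_self C).trans (le_max_left _ _)
  · refine (hD x hx η hQ).trans ?_
    have hu : 1 ≤ ‖η‖ / δ := (one_le_div hδ).2 hη
    have h1 : 1 + ‖η‖ ≤ (1 + δ) / δ ^ k * ‖η‖ ^ k := by
      calc 1 + ‖η‖ = 1 + δ * (‖η‖ / δ) := by field_simp
        _ ≤ (1 + δ) * (‖η‖ / δ) := by linarith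
        _ ≤ (1 + δ) * (‖η‖ / δ) ^ k := by gcongr; exact le_self_pow₀ hu hk
        _ = (1 + δ) / δ ^ k * ‖η‖ ^ k := by rw [div_pow]; ring
    calc D * (1 + ‖η‖) ≤ |D| * (1 + ‖η‖) := by gcongr; exact le_abs_self D
      _ ≤ |D| * ((1 + δ) / δ ^ k * ‖η‖ ^ k) := by gcongr
      _ = |D| * ((1 + δ) / δ ^ k) * ‖η‖ ^ k := by ring
      _ ≤ _ := by gcongr; exact le_max_right _ _

theorem IsRetraction.exists_abs_sub_le {R : TangentBundle 𝓘(ℝ, E) M → M} (hR : IsRetraction R)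
    {G : M → ℝ} (hG : ContMDiff 𝓘(ℝ, E) 𝓘(ℝ, ℝ) 1 G) {Ω : Set M} (hΩ : IsCompact Ω) :
    ∃ C, 0 ≤ C ∧ ∀ x ∈ Ω, ∀ η : TangentSpace 𝓘(ℝ, E) x, R ⟨x, η⟩ ∈ Ω →
      |G (R ⟨x, η⟩) - G x| ≤ C * ‖η‖ := by
  obtain ⟨K, hK⟩ := hΩ.exists_bound_of_continuousOn hG.continuous.continuousOn
  have hloc : ∀ x₀ : M, ∃ C, ∃ δ > 0, ∀ᶠ x in 𝓝 x₀, ∀ η : TangentSpace 𝓘(ℝ, E) x, ‖η‖ < δ →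
      |G (R ⟨x, η⟩) - G x| ≤ C * ‖η‖ ^ 1 := by
    intro x₀
    have h1 : ContMDiffAt (𝓘(ℝ, E)).tangent 𝓘(ℝ, ℝ) 1 (G ∘ R) ⟨x₀, 0⟩ :=
      (hG _).comp _ ((hR.smooth _).of_le (by simp))
    obtain ⟨C, δ, hδ, h⟩ := eventually_abs_sub_zeroSection_le h1
    refine ⟨C, δ, hδ, h.mono fun x hx η hη => ?_⟩
    simpa [hR.map_zero] using hx η hη
  simpa using exists_forall_le_mul_norm_pow hΩ one_ne_zero hloc
    (Q := fun x η => R ⟨x, η⟩ ∈ Ω) (D := 2 * |K|) fun x hx η hη => by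
      have h1 := hK x hx
      have h2 := hK _ hη
      rw [Real.norm_eq_abs] at h1 h2
      have h3 := abs_sub (G (R ⟨x, η⟩)) (G x)
      have h4 : 0 ≤ 2 * |K| * ‖η‖ := by positivity
      linarith [le_abs_self K]

theorem IsRetraction.exists_abs_taylor_le {R : TangentBundle 𝓘(ℝ, E) M → M} (hR : IsRetraction R)
    {f : M → ℝ} (hf : ContMDiff 𝓘(ℝ, E) 𝓘(ℝ, ℝ) 2 f) {Ω : Set M} (hΩ : IsCompact Ω) :
    ∃ C, 0 ≤ C ∧ ∀ x ∈ Ω, ∀ η : TangentSpace 𝓘(ℝ, E) x, R ⟨x, η⟩ ∈ Ω →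
      |f (R ⟨x, η⟩) - f x - inner ℝ (grad f x) η| ≤ C * ‖η‖ ^ 2 := by
  obtain ⟨K, hK⟩ := hΩ.exists_bound_of_continuousOn hf.continuous.continuousOn
  obtain ⟨L, hL⟩ := norm_grad_bounded hf hΩ
  have hloc : ∀ x₀ : M, ∃ C, ∃ δ > 0, ∀ᶠ x in 𝓝 x₀, ∀ η : TangentSpace 𝓘(ℝ, E) x, ‖η‖ < δ →
      |f (R ⟨x, η⟩) - f x - inner ℝ (grad f x) η| ≤ C * ‖η‖ ^ 2 := by
    intro x₀
    have h1 : ContMDiffAt (𝓘(ℝ, E)).tangent 𝓘(ℝ, ℝ) 2 (f ∘ R) ⟨x₀, 0⟩ :=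
      (hf _).comp _ ((hR.smooth _).of_le ENat.LEInfty.out)
    obtain ⟨C, δ, hδ, h⟩ := eventually_abs_taylor_zeroSection_le h1
    refine ⟨C, δ, hδ, h.mono fun x hx η hη => ?_⟩
    simpa [hR.map_zero] using hx η hη _
      (hR.hasDerivAt ((hf x).mdifferentiableAt (by norm_num)) η)
  refine exists_forall_le_mul_norm_pow hΩ two_ne_zero hloc
    (Q := fun x η => R ⟨x, η⟩ ∈ Ω) (D := 2 * |K| + |L|) fun x hx η hη => ?_
  have h1 := hK x hx
  have h2 := hK _ hη
  rw [Real.norm_eq_abs] at h1 h2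
  have h3 := abs_sub (f (R ⟨x, η⟩) - f x) (inner ℝ (grad f x) η)
  have h4 := abs_sub (f (R ⟨x, η⟩)) (f x)
  have h5 : |inner ℝ (grad f x) η| ≤ |L| * ‖η‖ :=
    (abs_real_inner_le_norm _ _).trans (by gcongr; exact (hL x hx).trans (le_abs_self L))
  have h6 : 0 ≤ 2 * |K| * ‖η‖ := by positivity
  have h7 : 0 ≤ |L| := abs_nonneg L
  linarith [le_abs_self K]

end Metric

/-! ### Norms of transported vectors and batch averages -/

theorem IsIsometricTransport.norm_map {R : TangentBundle 𝓘(ℝ, E) M → M}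
    {T : ∀ (x : M) (η : TangentSpace 𝓘(ℝ, E) x),
      TangentSpace 𝓘(ℝ, E) x →ₗ[ℝ] TangentSpace 𝓘(ℝ, E) (R ⟨x, η⟩)}
    (hT : IsIsometricTransport R T) (x : M) (η ξ : TangentSpace 𝓘(ℝ, E) x) :
    ‖T x η ξ‖ = ‖ξ‖ := by
  rw [← sq_eq_sq₀ (norm_nonneg _) (norm_nonneg _), ← real_inner_self_eq_norm_sq,
    ← real_inner_self_eq_norm_sq, hT]

theorem IsIsometricTransport.norm_transportTo_le {R : TangentBundle 𝓘(ℝ, E) M → M}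
    {T : ∀ (x : M) (η : TangentSpace 𝓘(ℝ, E) x),
      TangentSpace 𝓘(ℝ, E) x →ₗ[ℝ] TangentSpace 𝓘(ℝ, E) (R ⟨x, η⟩)}
    (hT : IsIsometricTransport R T) (ρ : ℝ) (x y : M) (ξ : TangentSpace 𝓘(ℝ, E) x) :
    ‖transportTo R T ρ x y ξ‖ ≤ ‖ξ‖ := by
  -- With `y` a variable, the cast along `R ⟨x, η⟩ = y` disappears.
  have key : ∀ (η : TangentSpace 𝓘(ℝ, E) x) (y : M) (hy : R ⟨x, η⟩ = y),
      ‖(hy ▸ T x η : TangentSpace 𝓘(ℝ, E) x →ₗ[ℝ] TangentSpace 𝓘(ℝ, E) y) ξ‖ = ‖ξ‖ := by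
    rintro η y rfl
    exact hT.norm_map x η ξ
  unfold transportTo
  split_ifs with h
  · exact (key _ _ _).le
  · simp

theorem grad_objective {n : ℕ} {fs : Fin n → M → ℝ} {x : M}
    (hfs : ∀ i, MDifferentiableAt 𝓘(ℝ, E) 𝓘(ℝ, ℝ) (fs i) x) :
    grad (E := E) (objective fs) x = (1 / (n : ℝ)) • ∑ i, grad (fs i) x := by
  let D : Fin n → TangentSpace 𝓘(ℝ, E) x →L[ℝ] ℝ := fun i => mfderiv 𝓘(ℝ, E) 𝓘(ℝ, ℝ) (fs i) x
  have h1 : HasMFDerivAt 𝓘(ℝ, E) 𝓘(ℝ, ℝ) (objective fs) x ((1 / (n : ℝ)) • ∑ i, D i) := by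
    have h2 : HasMFDerivAt 𝓘(ℝ, E) 𝓘(ℝ, ℝ) (∑ i, fs i) x (∑ i, D i) :=
      HasMFDerivAt.sum fun i _ => (hfs i).hasMFDerivAt
    have h3 : objective fs = (1 / (n : ℝ)) • ∑ i, fs i := by
      ext y
      simp [objective]
    rw [h3]
    exact h2.const_smul (1 / (n : ℝ))
  refine ext_inner_right ℝ fun ξ => ?_
  rw [inner_grad, h1.mfderiv, real_inner_smul_left, sum_inner]
  simp only [inner_grad]
  have h4 : (∑ i, D i) ξ = ∑ i, D i ξ := sum_apply _ _ _
  exact congrArg ((1 / (n : ℝ)) * ·) h4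

theorem norm_batchGrad_le {n : ℕ} {fs : Fin n → M → ℝ} {x : M} {L : ℝ} (hL : 0 ≤ L)
    (h : ∀ i, ‖grad (E := E) (fs i) x‖ ≤ L) (J : Finset (Fin n)) :
    ‖batchGrad (E := E) fs J x‖ ≤ L := by
  unfold batchGrad
  rw [norm_smul]
  have h1 : ‖∑ i ∈ J, grad (E := E) (fs i) x‖ ≤ J.card * L := by
    simpa using norm_sum_le_of_le J fun i _ => h i
  -- The empty batch has mean `0`, as `1 / 0 = 0`.
  rcases J.eq_empty_or_nonempty with rfl | hJ
  · simpa using hL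
  · have hc : 0 < (J.card : ℝ) := by exact_mod_cast hJ.card_pos
    rw [Real.norm_eq_abs, abs_of_nonneg (by positivity), one_div, inv_mul_le_iff₀ hc]
    exact h1

/-- Averaging the mini-batch means over all batches of a given size gives the full mean. -/
theorem sum_powersetCard_mean {V : Type*} [AddCommGroup V] [Module ℝ V] {n b : ℕ} (hb : 1 ≤ b)
    (hbn : b ≤ n) (v : Fin n → V) :
    ∑ J ∈ Finset.powersetCard b (Finset.univ : Finset (Fin n)),
      ((n.choose b : ℝ)⁻¹) • ((1 / (J.card : ℝ)) • ∑ i ∈ J, v i) = (1 / (n : ℝ)) • ∑ i, v i := by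
  classical
  -- Double counting: each index lies in `(n - 1).choose (b - 1)` batches.
  have hcard : ∀ i : Fin n, ((Finset.powersetCard b (Finset.univ : Finset (Fin n))).filter
      (i ∈ ·)).card = (n - 1).choose (b - 1) := by
    intro i
    have : ((Finset.univ : Finset (Fin n)).erase i).card = n - 1 := by simp
    rw [← this, ← Finset.card_powersetCard]
    refine Finset.card_nbij' (fun J => J.erase i) (fun J => insert i J) ?_ ?_ ?_ ?_
    · intro J hJ
      simp only [Finset.coe_filter, Finset.mem_powersetCard, Finset.subset_univ, true_and,
        Set.mem_ofPred_eq] at hJ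
      simp only [Finset.mem_coe, Finset.mem_powersetCard]
      exact ⟨Finset.erase_subset_erase _ (Finset.subset_univ _), by
        rw [Finset.card_erase_of_mem hJ.2, hJ.1]⟩
    · intro J hJ
      simp only [Finset.mem_coe, Finset.mem_powersetCard] at hJ
      simp only [Finset.coe_filter, Finset.mem_powersetCard, Finset.subset_univ, true_and,
        Set.mem_ofPred_eq]
      have hi : i ∉ J := fun h => by simpa using hJ.1 h
      refine ⟨?_, Finset.mem_insert_self _ _⟩
      rw [Finset.card_insert_of_notMem hi, hJ.2]; omega
    · intro J hJ
      simp only [Finset.coe_filter, Set.mem_ofPred_eq] at hJ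
      exact Finset.insert_erase hJ.2
    · intro J hJ
      simp only [Finset.mem_coe, Finset.mem_powersetCard] at hJ
      exact Finset.erase_insert fun h => by simpa using hJ.1 h
  have hchoose : (n : ℝ) * (n - 1).choose (b - 1) = n.choose b * b := by
    have := Nat.add_one_mul_choose_eq (n - 1) (b - 1)
    have h1 : n - 1 + 1 = n := by omega
    have h2 : b - 1 + 1 = b := by omega
    rw [h1, h2] at this
    exact_mod_cast this
  have hn0 : (n : ℝ) ≠ 0 := by exact_mod_cast (by omega : n ≠ 0)
  have hb0 : (b : ℝ) ≠ 0 := by exact_mod_cast (by omega : b ≠ 0)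
  have hc0 : (n.choose b : ℝ) ≠ 0 := by exact_mod_cast (Nat.choose_pos hbn).ne'
  calc ∑ J ∈ Finset.powersetCard b (Finset.univ : Finset (Fin n)),
        ((n.choose b : ℝ)⁻¹) • ((1 / (J.card : ℝ)) • ∑ i ∈ J, v i)
      = ((n.choose b : ℝ)⁻¹ * (1 / (b : ℝ))) •
          ∑ J ∈ Finset.powersetCard b (Finset.univ : Finset (Fin n)), ∑ i ∈ J, v i := by
        rw [Finset.smul_sum]
        refine Finset.sum_congr rfl fun J hJ => ?_
        rw [(Finset.mem_powersetCard.1 hJ).2, smul_smul]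
    _ = ((n.choose b : ℝ)⁻¹ * (1 / (b : ℝ))) • ∑ i, ((n - 1).choose (b - 1) : ℝ) • v i := by
        congr 1
        rw [Finset.sum_comm' (t' := Finset.univ) (s' := fun i =>
          (Finset.powersetCard b (Finset.univ : Finset (Fin n))).filter (i ∈ ·)) (by simp)]
        refine Finset.sum_congr rfl fun i _ => ?_
        rw [Finset.sum_const, hcard, Nat.cast_smul_eq_nsmul]
    _ = (1 / (n : ℝ)) • ∑ i, v i := by
        rw [← Finset.smul_sum, smul_smul]
        congr 1
        field_simp
        linarith

/-! ### The descent direction and its dependence on the batches -/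

namespace Input

variable {n : ℕ} (A : Input E M n)

theorem adaptedPsi_nonneg (hμ : 0 ≤ A.μ) {a ψ : ℝ} (hψ : 0 ≤ ψ) (p : TangentBundle 𝓘(ℝ, E) M) :
    0 ≤ A.adaptedPsi a ψ p := by
  unfold adaptedPsi
  split_ifs
  · exact le_min hψ (by positivity)
  · exact hψ

theorem adaptedPsi_le (a ψ : ℝ) (p : TangentBundle 𝓘(ℝ, E) M) : A.adaptedPsi a ψ p ≤ ψ := by
  unfold adaptedPsi
  split_ifs
  · exact min_le_left _ _
  · exact le_rfl

/-- This is the purpose of the cap: `ψ̃ |c| ≤ μ ‖grad f‖²`, whatever the sign of `c`. -/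
theorem neg_le_adaptedPsi_mul_bias (hμ : 0 ≤ A.μ) {a ψ : ℝ} (hψ : 0 ≤ ψ)
    (p : TangentBundle 𝓘(ℝ, E) M) :
    -(A.μ * ‖grad (E := E) A.f (A.move a p)‖ ^ 2) ≤ A.adaptedPsi a ψ p * A.bias a p := by
  by_cases h : A.bias a p = 0
  · rw [h, mul_zero, neg_nonpos]; positivity
  · have h0 := A.adaptedPsi_nonneg hμ (a := a) hψ p
    have h1 : A.adaptedPsi a ψ p ≤ A.μ * ‖grad (E := E) A.f (A.move a p)‖ ^ 2 / |A.bias a p| := by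
      unfold adaptedPsi
      rw [if_pos h]
      exact min_le_right _ _
    rw [le_div_iff₀ (abs_pos.2 h)] at h1
    have h2 := mul_le_mul_of_nonneg_left (neg_abs_le (A.bias a p)) h0
    linarith

/-- The direction is a convex combination of vectors of norm at most `3 L`, `2 L + ‖p.2‖` and `L`.
-/
theorem norm_direction_le (hT : IsIsometricTransport A.R A.T) (hμ : 0 ≤ A.μ) {a φ ψ L : ℝ}
    (hφ : 0 ≤ φ) (hψ : 0 ≤ ψ) (hφψ : ψ + φ ≤ 1) (hL : 0 ≤ L) (J : Finset (Fin n)) (x₀ : M)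
    (p : TangentBundle 𝓘(ℝ, E) M)
    (hy : ‖batchGrad (E := E) A.fs J (A.move a p)‖ ≤ L)
    (hx₀ : ‖batchGrad (E := E) A.fs J x₀‖ ≤ L) (hg : ‖grad (E := E) A.f x₀‖ ≤ L)
    (hp : ‖batchGrad (E := E) A.fs J p.1‖ ≤ L) :
    ‖A.direction a φ ψ J x₀ p‖ ≤ 3 * L + ‖p.2‖ := by
  have h0 := A.adaptedPsi_nonneg hμ (a := a) hψ p
  have h1 := A.adaptedPsi_le a ψ p
  set θ := A.adaptedPsi a ψ p with hθ
  unfold direction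
  rw [← hθ]
  have e1 : ‖batchGrad (E := E) A.fs J (A.move a p)
      - transportTo A.R A.T A.ρ x₀ (A.move a p) (batchGrad A.fs J x₀ - grad A.f x₀)‖ ≤ 3 * L := by
    have := (norm_sub_le (batchGrad (E := E) A.fs J (A.move a p))
      (transportTo A.R A.T A.ρ x₀ (A.move a p) (batchGrad A.fs J x₀ - grad A.f x₀)))
    have h2 := hT.norm_transportTo_le A.ρ x₀ (A.move a p) (batchGrad A.fs J x₀ - grad A.f x₀)
    have h3 := norm_sub_le (batchGrad (E := E) A.fs J x₀) (grad A.f x₀)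
    linarith
  have e2 : ‖batchGrad (E := E) A.fs J (A.move a p)
      - A.moveTransport a p (batchGrad A.fs J p.1 - p.2)‖ ≤ 2 * L + ‖p.2‖ := by
    have := (norm_sub_le (batchGrad (E := E) A.fs J (A.move a p))
      (A.moveTransport a p (batchGrad A.fs J p.1 - p.2)))
    have h2 : ‖A.moveTransport a p (batchGrad A.fs J p.1 - p.2)‖ = ‖batchGrad A.fs J p.1 - p.2‖ :=
      hT.norm_map _ _ _
    have h3 := norm_sub_le (batchGrad (E := E) A.fs J p.1) p.2
    linarith
  refine (norm_add₃_le).trans ?_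
  rw [norm_smul, norm_smul, norm_smul, Real.norm_of_nonneg hφ, Real.norm_of_nonneg h0,
    Real.norm_of_nonneg (by linarith : 0 ≤ 1 - φ - θ)]
  have f1 := mul_le_mul_of_nonneg_left e1 hφ
  have f2 := mul_le_mul_of_nonneg_left e2 h0
  have f3 := mul_le_mul_of_nonneg_left hy (by linarith : 0 ≤ 1 - φ - θ)
  have g1 : θ * ‖p.2‖ ≤ ‖p.2‖ := mul_le_of_le_one_left (norm_nonneg _) (by linarith)
  have g2 := mul_nonneg hφ hL
  have g3 := mul_nonneg h0 hL
  have g4 : φ * L + θ * L ≤ L := by nlinarith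
  linarith

/-- If a random batch is unbiased, the mean of the new direction makes an acute angle with the
gradient. -/
theorem le_sum_inner_direction (hμ : 0 ≤ A.μ) {a φ ψ : ℝ} (hψ : 0 ≤ ψ)
    {w : Finset (Fin n) → ℝ} (hw : ∑ J, w J = 1)
    (hmean : ∀ x, ∑ J, w J • batchGrad (E := E) A.fs J x = grad A.f x) (x₀ : M)
    (p : TangentBundle 𝓘(ℝ, E) M) :
    (1 - A.μ) * ‖grad (E := E) A.f (A.move a p)‖ ^ 2 ≤
      ∑ J, w J * inner ℝ (A.direction a φ ψ J x₀ p) (grad A.f (A.move a p)) := by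
  set θ := A.adaptedPsi a ψ p with hθ
  set g := grad (E := E) A.f (A.move a p) with hg
  set T₀ := transportTo A.R A.T A.ρ x₀ (A.move a p)
  set T₁ := A.moveTransport a p
  -- In the mean the `φ` correction vanishes, because `batchGrad` at `x₀` averages to `grad f(x₀)`;
  -- only the transported error of the previous direction survives.
  have h1 : ∑ J, w J • A.direction a φ ψ J x₀ p = g + θ • T₁ (p.2 - grad A.f p.1) := by
    have h2 : ∀ J, w J • A.direction a φ ψ J x₀ p = w J • batchGrad A.fs J (A.move a p)
        - φ • T₀ (w J • batchGrad A.fs J x₀) + w J • (φ • T₀ (grad A.f x₀))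
        - θ • T₁ (w J • batchGrad A.fs J p.1) + w J • (θ • T₁ p.2) := by
      intro J
      unfold direction
      rw [← hθ, map_sub, map_sub, map_smul, map_smul]
      module
    simp only [h2]
    rw [Finset.sum_add_distrib, Finset.sum_sub_distrib, Finset.sum_add_distrib,
      Finset.sum_sub_distrib, ← Finset.smul_sum, ← Finset.smul_sum, ← map_sum, ← map_sum,
      ← Finset.sum_smul, ← Finset.sum_smul, hmean, hmean, hmean, hw, map_sub]
    module
  have h3 : ∑ J, w J * inner ℝ (A.direction a φ ψ J x₀ p) g =
      inner ℝ (∑ J, w J • A.direction a φ ψ J x₀ p) g := by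
    rw [sum_inner]
    refine Finset.sum_congr rfl fun J _ => ?_
    rw [real_inner_smul_left]
  rw [h3, h1, inner_add_left, real_inner_smul_left, real_inner_self_eq_norm_sq]
  have h4 := A.neg_le_adaptedPsi_mul_bias hμ (a := a) hψ p
  have h5 : A.bias a p = inner ℝ (T₁ (p.2 - grad A.f p.1)) g := rfl
  rw [← hθ, h5] at h4
  linarith

theorem innerLoop_congr {J J' : ℕ → ℕ → Finset (Fin n)} (s : ℕ) (x₀ : M) (t : ℕ)
    (h : ∀ i, 1 ≤ i → i ≤ t → J s i = J' s i) :
    A.innerLoop J s x₀ t = A.innerLoop J' s x₀ t := by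
  induction t with
  | zero => rfl
  | succ t ih =>
    rw [innerLoop, innerLoop, ih fun i hi hit => h i hi (by omega), h (t + 1) (by omega) le_rfl]

theorem snapshot_congr {J J' : ℕ → ℕ → Finset (Fin n)} (hm : 0 < A.m) (s : ℕ)
    (h : ∀ r < s, ∀ i, 1 ≤ i → i < A.m → J r i = J' r i) :
    A.snapshot J s = A.snapshot J' s := by
  induction s with
  | zero => rfl
  | succ s ih =>
    rw [snapshot, snapshot, ih fun r hr => h r (by omega),
      A.innerLoop_congr s _ _ fun i hi hit => h s (by omega) i hi (by omega)]

/-- Time is the linear index `s * m + t`. The state at a given time includes a direction, so it also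
depends on the batch drawn at that very time. -/
theorem state_congr {J J' : ℕ → ℕ → Finset (Fin n)} {s t : ℕ} (ht : t < A.m)
    (h : ∀ r i, 1 ≤ i → i < A.m → r * A.m + i ≤ s * A.m + t → J r i = J' r i) :
    A.state J s t = A.state J' s t := by
  have hs : A.snapshot J s = A.snapshot J' s :=
    A.snapshot_congr (by omega) s fun r hr i hi him => h r i hi him (by
      have : (r + 1) * A.m ≤ s * A.m := Nat.mul_le_mul_right _ hr
      rw [add_mul] at this
      omega)
  rw [state, state, hs]
  exact A.innerLoop_congr s _ t fun i hi hit => h s i hi (by omega) (by omega)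

theorem iterate_succ (hm : 0 < A.m) (J : ℕ → ℕ → Finset (Fin n)) (k : ℕ) :
    A.iterate J (k + 1) = A.move (A.α (k / A.m) (k % A.m)) (A.state J (k / A.m) (k % A.m)) := by
  have hk := Nat.mod_lt k hm
  have hdm := Nat.div_add_mod k A.m
  rcases Nat.lt_or_ge (k % A.m + 1) A.m with h | h
  · obtain ⟨h1, h2⟩ := (Nat.div_mod_unique (a := k + 1) (d := k / A.m) (c := k % A.m + 1) hm).2
      ⟨by omega, h⟩
    rw [iterate, h1, h2]
    rfl
  -- At the end of an epoch the next iterate is the new snapshot.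
  · have h0 : k % A.m = A.m - 1 := by omega
    have h1 : k + 1 = A.m * (k / A.m + 1) := by rw [mul_add]; omega
    rw [iterate, h1, Nat.mul_div_cancel_left _ hm, Nat.mul_mod_right, h0]
    rfl

end Input

/-! ### The filtration of the batches and their uniform law -/

namespace IsUniformSampling

variable {Ξ : Type*} [MeasurableSpace Ξ] {P : Measure Ξ} {n m : ℕ} {b : ℕ → ℕ → ℕ}
  {B : ℕ → ℕ → Ξ → Finset (Fin n)}

/-- The `σ`-algebra at time `k` is generated by the batches `B s t` with `s * m + t < k`. -/
def filtration (hB : IsUniformSampling P m b B) : Filtration ℕ ‹MeasurableSpace Ξ› where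
  seq k := ⨆ p ∈ {p : {p : ℕ × ℕ // 1 ≤ p.2 ∧ p.2 < m} | p.1.1 * m + p.1.2 < k},
    MeasurableSpace.comap (B p.1.1 p.1.2) inferInstance
  mono' := fun _ _ hkl => biSup_mono fun _ hp => lt_of_lt_of_le hp hkl
  le' := fun _ => iSup₂_le fun p _ => (hB.measurable _ _ p.2.1 p.2.2).comap_le

theorem measurable_filtration (hB : IsUniformSampling P m b B) {s t k : ℕ} (h1 : 1 ≤ t)
    (ht : t < m) (hk : s * m + t < k) : Measurable[hB.filtration k] (B s t) := by
  rw [measurable_iff_comap_le]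
  exact le_iSup₂_of_le (f := fun (p : {p : ℕ × ℕ // 1 ≤ p.2 ∧ p.2 < m})
    (_ : p ∈ {p : {p : ℕ × ℕ // 1 ≤ p.2 ∧ p.2 < m} | p.1.1 * m + p.1.2 < k}) =>
    MeasurableSpace.comap (B p.1.1 p.1.2) inferInstance) ⟨(s, t), h1, ht⟩ hk le_rfl

theorem indep_filtration (hB : IsUniformSampling P m b B) {s t k : ℕ} (h1 : 1 ≤ t)
    (ht : t < m) (hk : k ≤ s * m + t) :
    Indep (MeasurableSpace.comap (B s t) inferInstance) (hB.filtration k) P := by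
  have h := indep_iSup_of_disjoint
    (m := fun p : {p : ℕ × ℕ // 1 ≤ p.2 ∧ p.2 < m} =>
      MeasurableSpace.comap (B p.1.1 p.1.2) inferInstance)
    (fun p => (hB.measurable _ _ p.2.1 p.2.2).comap_le) hB.indep.iIndep
    (S := {⟨(s, t), h1, ht⟩}) (T := {p | p.1.1 * m + p.1.2 < k}) (by
      rw [Set.disjoint_singleton_left]
      exact not_lt.2 hk)
  rw [iSup_singleton] at h
  exact h

/-- A quantity that depends only on the batches before time `k` is a simple function, measurable
with respect to the `σ`-algebra at time `k`. -/
theorem stronglyMeasurable_and_integrable [IsProbabilityMeasure P]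
    (hB : IsUniformSampling P m b B) {k : ℕ}
    {u : (ℕ → ℕ → Finset (Fin n)) → ℝ}
    (hu : ∀ J J', (∀ s t, 1 ≤ t → t < m → s * m + t < k → J s t = J' s t) → u J = u J') :
    StronglyMeasurable[hB.filtration k] (fun x => u fun s t => B s t x) ∧
      Integrable (fun x => u fun s t => B s t x) P := by
  classical
  -- `h` records the batches before time `k` in a finite type, and the quantity factors through it.
  -- No measurable structure on `M` is involved.
  let h : Ξ → Fin k → Finset (Fin n) := fun x j =>
    if 1 ≤ (j : ℕ) % m ∧ (j : ℕ) % m < m then B (j / m) (j % m) x else ∅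
  let v : (Fin k → Finset (Fin n)) → ℝ := fun c =>
    u fun s t => if hst : s * m + t < k then c ⟨s * m + t, hst⟩ else ∅
  have heq : (fun x => u fun s t => B s t x) = fun x => v (h x) := by
    funext x
    refine hu _ _ fun s t h1 ht hk => ?_
    have hdiv : (s * m + t) / m = s := by
      rw [mul_comm, Nat.mul_add_div (by omega), Nat.div_eq_of_lt ht, add_zero]
    have hmod : (s * m + t) % m = t := by
      rw [mul_comm, Nat.mul_add_mod, Nat.mod_eq_of_lt ht]
    simp [h, hk, hdiv, hmod, h1, ht]
  have hmeas : Measurable[hB.filtration k] h := by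
    refine @measurable_pi_lambda _ _ _ (hB.filtration k) _ _ fun j => ?_
    by_cases hj : 1 ≤ (j : ℕ) % m ∧ (j : ℕ) % m < m
    · simp only [h, hj, and_self, if_true]
      exact hB.measurable_filtration hj.1 hj.2 (by rw [mul_comm, Nat.div_add_mod]; exact j.2)
    · simp only [h, hj, if_false]
      exact measurable_const
  have hsm : StronglyMeasurable[hB.filtration k] (fun x => v (h x)) :=
    (Measurable.of_discrete (f := v)).stronglyMeasurable.comp_measurable hmeas
  rw [heq]
  refine ⟨hsm, ?_⟩
  obtain ⟨C, hC⟩ := (Set.finite_range fun c => ‖v c‖).bddAbove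
  exact Integrable.of_bound (hsm.mono (hB.filtration.le k)).aestronglyMeasurable C
    (Eventually.of_forall fun x => hC ⟨h x, rfl⟩)

theorem measureReal_preimage [IsProbabilityMeasure P] (hB : IsUniformSampling P m b B) {s t : ℕ}
    (h1 : 1 ≤ t) (ht : t < m) (J : Finset (Fin n)) :
    P.real (B s t ⁻¹' {J}) = if J ∈ Finset.powersetCard (b s t) Finset.univ
      then ((n.choose (b s t) : ℝ))⁻¹ else 0 := by
  have hcard : ∀ J ∈ Finset.powersetCard (b s t) (Finset.univ : Finset (Fin n)),
      P.real (B s t ⁻¹' {J}) = ((n.choose (b s t) : ℝ))⁻¹ := by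
    intro J hJ
    have := hB.uniform s t h1 ht J (Finset.mem_powersetCard.1 hJ).2
    rw [measureReal_def, show B s t ⁻¹' {J} = {x | B s t x = J} from rfl, this]
    simp
  split_ifs with hJ
  · exact hcard J hJ
  -- The sets of the prescribed size already carry total mass `1`, so any other set is null.
  · have hsum := sum_measureReal_preimage_singleton (μ := P) (f := B s t)
      (insert J (Finset.powersetCard (b s t) Finset.univ))
      (fun y _ => hB.measurable s t h1 ht (measurableSet_singleton y))
    have hle : P.real (B s t ⁻¹'
        (insert J (Finset.powersetCard (b s t) Finset.univ) : Finset (Finset (Fin n)))) ≤ 1 :=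
      measureReal_le_one
    rw [← hsum, Finset.sum_insert hJ, Finset.sum_congr rfl hcard, Finset.sum_const,
      Finset.card_powersetCard, Finset.card_univ, Fintype.card_fin, nsmul_eq_mul,
      mul_inv_cancel₀ (by exact_mod_cast (Nat.choose_pos (hB.card_le s t h1 ht)).ne')] at hle
    exact le_antisymm (by linarith) measureReal_nonneg

theorem sum_measureReal_preimage_eq_one [IsProbabilityMeasure P] (hB : IsUniformSampling P m b B)
    {s t : ℕ} (h1 : 1 ≤ t) (ht : t < m) : ∑ J, P.real (B s t ⁻¹' {J}) = 1 := by
  rw [sum_measureReal_preimage_singleton Finset.univ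
    (fun y _ => hB.measurable s t h1 ht (measurableSet_singleton y))]
  simp

theorem sum_smul_batchGrad [IsProbabilityMeasure P] (hB : IsUniformSampling P m b B)
    {s t : ℕ} (h1 : 1 ≤ t) (ht : t < m) {fs : Fin n → M → ℝ} {x : M}
    (hfs : ∀ i, MDifferentiableAt 𝓘(ℝ, E) 𝓘(ℝ, ℝ) (fs i) x) :
    ∑ J, P.real (B s t ⁻¹' {J}) • batchGrad (E := E) fs J x = grad (objective fs) x := by
  rw [grad_objective hfs, ← sum_powersetCard_mean (hB.one_le_card s t h1 ht)
    (hB.card_le s t h1 ht)]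
  simp only [hB.measureReal_preimage h1 ht, ite_smul, zero_smul]
  rw [Finset.sum_ite_mem, Finset.univ_inter]
  rfl

end IsUniformSampling

/-! ### Step sizes in linear order and boundedness of the directions -/

theorem sum_range_div_mod {m : ℕ} (hm : 0 < m) (a : ℕ → ℕ → ℝ) (S : ℕ) :
    ∑ s ∈ Finset.range S, ∑ t ∈ Finset.range m, a s t =
      ∑ k ∈ Finset.range (S * m), a (k / m) (k % m) := by
  induction S with
  | zero => simp
  | succ S ih =>
    rw [Finset.sum_range_succ, ih, add_mul, one_mul, Finset.sum_range_add]
    congr 1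
    refine Finset.sum_congr rfl fun t ht => ?_
    have ht := Finset.mem_range.1 ht
    rw [mul_comm, Nat.mul_add_div hm, Nat.div_eq_of_lt ht, add_zero, Nat.mul_add_mod,
      Nat.mod_eq_of_lt ht]

namespace Input

variable {n : ℕ} {A : Input E M n}

theorem DecayingSteps.not_summable (h : A.DecayingSteps) (hA : A.Admissible) :
    ¬ Summable fun k => A.α (k / A.m) (k % A.m) := by
  intro hs
  have h1 := h.sum_diverges
  simp only [sum_range_div_mod hA.m_pos] at h1
  refine not_tendsto_nhds_of_tendsto_atTop h1 _ (hs.hasSum.tendsto_sum_nat.comp ?_)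
  exact tendsto_id.atTop_mul_const' hA.m_pos

theorem DecayingSteps.summable_sq (h : A.DecayingSteps) (hA : A.Admissible) :
    Summable fun k => A.α (k / A.m) (k % A.m) ^ 2 := by
  refine summable_of_sum_range_le (fun _ => sq_nonneg _)
    (c := ∑' s, ∑ t ∈ Finset.range A.m, A.α s t ^ 2) fun k => ?_
  -- The first `k` steps lie within the first `k` epochs.
  calc ∑ j ∈ Finset.range k, A.α (j / A.m) (j % A.m) ^ 2
      ≤ ∑ j ∈ Finset.range (k * A.m), A.α (j / A.m) (j % A.m) ^ 2 :=
        Finset.sum_le_sum_of_subset_of_nonneg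
          (Finset.range_mono (Nat.le_mul_of_pos_right k hA.m_pos)) fun _ _ _ => sq_nonneg _
    _ = ∑ s ∈ Finset.range k, ∑ t ∈ Finset.range A.m, A.α s t ^ 2 :=
        (sum_range_div_mod hA.m_pos (fun s t => A.α s t ^ 2) k).symm
    _ ≤ _ := h.sum_sq_summable.sum_le_tsum _ fun _ _ => Finset.sum_nonneg fun _ _ => sq_nonneg _

variable (A) in
/-- The directions stay bounded as long as the iterates stay in a set on which all the gradients
are bounded. -/
theorem norm_state_snd_le (hT : IsIsometricTransport A.R A.T) (hA : A.Admissible) {L : ℝ}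
    (hL : 0 ≤ L) {Ω : Set M} (hfs : ∀ y ∈ Ω, ∀ i, ‖grad (E := E) (A.fs i) y‖ ≤ L)
    (hf : ∀ y ∈ Ω, ‖grad (E := E) A.f y‖ ≤ L) {J : ℕ → ℕ → Finset (Fin n)} {s : ℕ}
    (hΩ : ∀ t < A.m, (A.state J s t).1 ∈ Ω) {t : ℕ} (ht : t < A.m) :
    ‖(A.state J s t).2‖ ≤ (3 * t + 1) * L := by
  induction t with
  | zero =>
    have h : ‖(A.state J s 0).2‖ ≤ L := hf _ (hΩ 0 ht)
    simpa using h
  | succ t ih =>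
    have h0 := hΩ 0 hA.m_pos
    have hy := hΩ (t + 1) ht
    have hp := hΩ t (by omega)
    have h1 := A.norm_direction_le hT hA.μ_pos.le (a := A.α s t)
      (hA.φ_nonneg s (t + 1) (by omega) ht) (hA.ψ_nonneg s (t + 1) (by omega) ht)
      (hA.add_le_one s (t + 1) (by omega) ht) hL (J s (t + 1)) (A.snapshot J s) (A.state J s t)
      (norm_batchGrad_le hL (hfs _ hy) _) (norm_batchGrad_le hL (hfs _ h0) _) (hf _ h0)
      (norm_batchGrad_le hL (hfs _ hp) _)
    have h2 := ih (by omega)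
    push_cast
    refine h1.trans ?_
    linarith

end Input

end RSHG

end

/-! ### Almost sure convergence of the algorithm -/

theorem theorem2
    {E : Type*} [NormedAddCommGroup E] [NormedSpace ℝ E] [FiniteDimensional ℝ E]
    {M : Type*} [TopologicalSpace M] [T2Space M] [ChartedSpace E M] [IsManifold 𝓘(ℝ, E) ∞ M]
    [RiemannianBundle (fun x : M => TangentSpace 𝓘(ℝ, E) x)]
    [IsContMDiffRiemannianBundle 𝓘(ℝ, E) ∞ E (fun x : M => TangentSpace 𝓘(ℝ, E) x)]
    {n : ℕ} (hn : 0 < n) (A : RSHG.Input E M n)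
    -- retraction, isometric vector transport, requirements on the parameters
    (hR : RSHG.IsRetraction A.R) (hT : RSHG.IsVectorTransport A.R A.T)
    (hTiso : RSHG.IsIsometricTransport A.R A.T)
    (hA : A.Admissible) (hα : A.DecayingSteps)
    -- smoothness of the objective and of its components
    (hf : ContMDiff 𝓘(ℝ, E) 𝓘(ℝ, ℝ) 3 A.f)
    (hfs : ∀ i, ContMDiff 𝓘(ℝ, E) 𝓘(ℝ, ℝ) 2 (A.fs i))
    -- random batches
    {Ξ : Type*} [MeasurableSpace Ξ] (P : Measure Ξ) [IsProbabilityMeasure P]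
    (b : ℕ → ℕ → ℕ) (B : ℕ → ℕ → Ξ → Finset (Fin n))
    (hB : RSHG.IsUniformSampling P A.m b B)
    -- the compact totally retractive neighbourhood that contains the iterates
    (ωstar : M) (Ω : Set M) (hΩ : IsCompact Ω) (hΩnhds : Ω ∈ 𝓝 ωstar)
    (hρ : 0 < A.ρ) (hΩretr : RSHG.IsTotallyRetractive A.R A.ρ Ω)
    (hstay : ∀ᵐ x ∂P, ∀ s, ∀ t < A.m, ∀ τ ∈ Set.Icc (0 : ℝ) 1,
      A.move (τ * A.α s t) (A.state (fun s t => B s t x) s t) ∈ Ω)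
    -- non-negativity of the objective
    (hf0 : ∀ y, 0 ≤ A.f y) :
    (∀ᵐ x ∂P, Tendsto
      (fun k => ‖RSHG.grad (E := E) A.f (A.iterate (fun s t => B s t x) k)‖) atTop (𝓝 0)) ∧
    ∃ X : Ξ → ℝ, Measurable X ∧
      ∀ᵐ x ∂P, Tendsto
        (fun k => A.f (A.iterate (fun s t => B s t x) k)) atTop (𝓝 (X x)) := by
  have hm := hA.m_pos
  have hf2 : ContMDiff 𝓘(ℝ, E) 𝓘(ℝ, ℝ) 2 A.f := hf.of_le (by norm_num)
  set α : ℕ → ℝ := fun k => A.α (k / A.m) (k % A.m) with hα_def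
  have hα0 : ∀ k, 0 < α k := fun k => hA.α_pos _ _ (Nat.mod_lt k hm)
  -- bounds on the compact set
  obtain ⟨L, hL, hLf, hLfs⟩ : ∃ L, 0 ≤ L ∧ (∀ y ∈ Ω, ‖RSHG.grad (E := E) A.f y‖ ≤ L) ∧
      ∀ y ∈ Ω, ∀ i, ‖RSHG.grad (E := E) (A.fs i) y‖ ≤ L := by
    obtain ⟨L, h⟩ := RSHG.norm_grad_bounded hf2 hΩ
    choose l hl using fun i => RSHG.norm_grad_bounded (hfs i) hΩ
    refine ⟨|L| + ∑ i, |l i|, by positivity, fun y hy => ?_, fun y hy i => ?_⟩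
    · have := Finset.sum_nonneg fun i (_ : i ∈ Finset.univ) => abs_nonneg (l i)
      linarith [h y hy, le_abs_self L]
    · have := Finset.single_le_sum (fun i _ => abs_nonneg (l i)) (Finset.mem_univ i)
      linarith [hl i y hy, le_abs_self (l i), abs_nonneg L]
  obtain ⟨C, hC, hTaylor⟩ := hR.exists_abs_taylor_le hf2 hΩ
  obtain ⟨D, hD, hLip⟩ := hR.exists_abs_sub_le
    (fun x => RSHG.contMDiffAt_norm_sq_grad (hf2 x)) hΩ
  -- Bounds `(3 t + 1) L` for every `t < m`.
  set K := (3 * (A.m : ℝ) + 1) * L with hK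
  have hK0 : 0 ≤ K := by positivity
  -- the processes, as functions of the batches
  let f (k : ℕ) (J : ℕ → ℕ → Finset (Fin n)) : ℝ := A.f (A.iterate J k)
  let G (k : ℕ) (J : ℕ → ℕ → Finset (Fin n)) : ℝ :=
    ‖RSHG.grad (E := E) A.f (A.iterate J k)‖ ^ 2
  let W (k : ℕ) (J : ℕ → ℕ → Finset (Fin n)) : ℝ :=
    inner ℝ (A.state J (k / A.m) (k % A.m)).2 (RSHG.grad A.f (A.iterate J k))
  have hidx : ∀ k, k / A.m * A.m + k % A.m = k := fun k => by
    rw [mul_comm]; exact Nat.div_add_mod k A.m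
  have hstate : ∀ k J J', (∀ s t, 1 ≤ t → t < A.m → s * A.m + t < k + 1 → J s t = J' s t) →
      A.state J (k / A.m) (k % A.m) = A.state J' (k / A.m) (k % A.m) := fun k J J' h =>
    A.state_congr (Nat.mod_lt k hm) fun r i h1 h2 h3 => h r i h1 h2 (by rw [hidx] at h3; omega)
  have hiter : ∀ k J J', (∀ s t, 1 ≤ t → t < A.m → s * A.m + t < k → J s t = J' s t) →
      A.iterate J k = A.iterate J' k := by
    rintro (_ | k) J J' h
    · simp [RSHG.Input.iterate, RSHG.Input.state, RSHG.Input.snapshot, RSHG.Input.innerLoop]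
    · rw [A.iterate_succ hm, A.iterate_succ hm, hstate k J J' h]
  have hfk := fun k => hB.stronglyMeasurable_and_integrable (k := k) (u := f k)
    fun J J' h => congrArg A.f (hiter k J J' h)
  have hGk := fun k => hB.stronglyMeasurable_and_integrable (k := k) (u := G k)
    fun J J' h => congrArg (fun y => ‖RSHG.grad (E := E) A.f y‖ ^ 2) (hiter k J J' h)
  -- Unlike `f k` and `G k`, the quantity `W k` uses the batch of time `k`, hence `k + 1`.
  have hWk := fun k => hB.stronglyMeasurable_and_integrable (k := k + 1) (u := W k)
    fun J J' h => congrArg (fun p : TangentBundle 𝓘(ℝ, E) M =>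
      inner ℝ p.2 (RSHG.grad A.f p.1)) (hstate k J J' h)
  -- almost sure bounds
  have hbounds : ∀ᵐ x ∂P, ∀ k, f (k + 1) (fun s t => B s t x) ≤
        f k (fun s t => B s t x) - α k * W k (fun s t => B s t x) + C * K ^ 2 * α k ^ 2 ∧
      |G (k + 1) (fun s t => B s t x) - G k (fun s t => B s t x)| ≤ D * K * α k := by
    filter_upwards [hstay] with x hx k
    set J : ℕ → ℕ → Finset (Fin n) := fun s t => B s t x
    have hin : ∀ s, ∀ t < A.m, (A.state J s t).1 ∈ Ω := by
      intro s t ht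
      have := hx s t ht 0 (by simp)
      simpa [RSHG.Input.move, hR.map_zero] using this
    have hk := Nat.mod_lt k hm
    set p := A.state J (k / A.m) (k % A.m) with hp
    have hnext : A.R ⟨p.1, -(α k • p.2)⟩ = A.iterate J (k + 1) := (A.iterate_succ hm J k).symm
    have hnextΩ : A.R ⟨p.1, -(α k • p.2)⟩ ∈ Ω := by
      rw [hnext]; exact hin _ _ (Nat.mod_lt _ hm)
    have hpK : ‖p.2‖ ≤ K := by
      refine (A.norm_state_snd_le hTiso hA hL hLfs hLf (hin _) hk).trans ?_
      have : ((k % A.m : ℕ) : ℝ) ≤ A.m := by exact_mod_cast hk.le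
      rw [hK]
      gcongr
    have hηK : ‖-(α k • p.2)‖ ≤ α k * K := by
      rw [norm_neg, norm_smul, Real.norm_of_nonneg (hα0 k).le]
      exact mul_le_mul_of_nonneg_left hpK (hα0 k).le
    constructor
    · have h1 := (abs_le.1 (hTaylor p.1 (hin _ _ hk) (-(α k • p.2)) hnextΩ)).2
      rw [hnext, inner_neg_right, real_inner_smul_right, real_inner_comm] at h1
      have h2 : C * ‖-(α k • p.2)‖ ^ 2 ≤ C * (α k * K) ^ 2 := by gcongr
      have h3 : W k J = inner ℝ p.2 (RSHG.grad A.f p.1) := rfl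
      have h4 : f k J = A.f p.1 := rfl
      have h5 : f (k + 1) J = A.f (A.iterate J (k + 1)) := rfl
      rw [h3, h4, h5]
      linarith
    · have h1 := hLip p.1 (hin _ _ hk) (-(α k • p.2)) hnextΩ
      rw [hnext] at h1
      refine h1.trans ?_
      have h2 : D * ‖-(α k • p.2)‖ ≤ D * (α k * K) := by gcongr
      linarith
  -- the conditional mean of the directional derivative
  have hcond : ∀ k, (fun x => (1 - A.μ) * G k fun s t => B s t x) ≤ᵐ[P]
      P[fun x => W k fun s t => B s t x | hB.filtration k] := by
    intro k
    obtain ⟨s, t, ht, rfl⟩ : ∃ s t, t < A.m ∧ k = s * A.m + t :=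
      ⟨k / A.m, k % A.m, Nat.mod_lt k hm, (hidx k).symm⟩
    have hdiv : (s * A.m + t) / A.m = s := by
      rw [mul_comm, Nat.mul_add_div hm, Nat.div_eq_of_lt ht, add_zero]
    have hmod : (s * A.m + t) % A.m = t := by
      rw [mul_comm, Nat.mul_add_mod, Nat.mod_eq_of_lt ht]
    have hst : ∀ J, A.state J ((s * A.m + t) / A.m) ((s * A.m + t) % A.m) = A.state J s t := by
      rw [hdiv, hmod]; exact fun _ => rfl
    have hWst : ∀ J, W (s * A.m + t) J = inner ℝ (A.state J s t).2
        (RSHG.grad A.f (A.state J s t).1) := fun J =>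
      congrArg (fun p : TangentBundle 𝓘(ℝ, E) M => inner ℝ p.2 (RSHG.grad A.f p.1)) (hst J)
    have hGst : ∀ J, G (s * A.m + t) J = ‖RSHG.grad (E := E) A.f (A.state J s t).1‖ ^ 2 := fun J =>
      congrArg (fun p : TangentBundle 𝓘(ℝ, E) M => ‖RSHG.grad (E := E) A.f p.1‖ ^ 2) (hst J)
    -- At the start of an epoch no batch is drawn and `V = grad f`, so `W = G`.
    rcases t with _ | t
    · have hWG : (fun x => W (s * A.m + 0) fun s t => B s t x) =
          fun x => G (s * A.m + 0) fun s t => B s t x := by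
        funext x
        rw [hWst, hGst]
        exact real_inner_self_eq_norm_sq (RSHG.grad (E := E) A.f _)
      rw [hWG, condExp_of_stronglyMeasurable (hB.filtration.le _) (hGk _).1 (hGk _).2]
      refine Eventually.of_forall fun x => ?_
      have : 0 ≤ G (s * A.m + 0) fun s t => B s t x := sq_nonneg _
      have := mul_nonneg hA.μ_pos.le this
      simp only
      linarith
    -- With the new batch frozen at `I`, the inner product depends only on the past; averaging over
    -- `I` is then the conditional expectation.
    · let w (I : Finset (Fin n)) (J : ℕ → ℕ → Finset (Fin n)) : ℝ :=
        inner ℝ (A.direction (A.α s t) (A.φ s (t + 1)) (A.ψ s (t + 1)) I (A.snapshot J s)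
          (A.state J s t)) (RSHG.grad A.f (A.move (A.α s t) (A.state J s t)))
      have hw := fun I => hB.stronglyMeasurable_and_integrable (k := s * A.m + (t + 1)) (u := w I)
        fun J J' h => by
          have h1 : A.state J s t = A.state J' s t :=
            A.state_congr (by omega) fun r i h1 h2 h3 => h r i h1 h2 (by omega)
          have h2 : A.snapshot J s = A.snapshot J' s :=
            A.snapshot_congr hm s fun r hr i hi him => h r i hi him (by
              have : (r + 1) * A.m ≤ s * A.m := Nat.mul_le_mul_right _ hr
              rw [add_mul] at this
              omega)
          simp only [w]
          rw [h1, h2]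
      have hWw : (fun x => W (s * A.m + (t + 1)) fun s t => B s t x) =
          fun x => w (B s (t + 1) x) fun s t => B s t x := funext fun x => hWst _
      have hcE := RSHG.condExp_apply_of_indep (hB.filtration.le _)
        (hB.measurable s (t + 1) (by omega) ht)
        (hB.indep_filtration (by omega) ht le_rfl)
        (w := fun I x => w I fun s t => B s t x) (fun I => (hw I).1) (fun I => (hw I).2)
      rw [hWw]
      filter_upwards [hcE] with x hx
      rw [hx]
      rw [hGst]
      exact A.le_sum_inner_direction hA.μ_pos.le (hA.ψ_nonneg s (t + 1) (by omega) ht)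
        (hB.sum_measureReal_preimage_eq_one (by omega) ht)
        (fun y => hB.sum_smul_batchGrad (by omega) ht fun i =>
          (hfs i y).mdifferentiableAt (by norm_num)) _ _
  obtain ⟨h1, h2⟩ := RSHG.ae_tendsto_of_descent (ℱ := hB.filtration)
    (f := fun k x => f k fun s t => B s t x) (G := fun k x => G k fun s t => B s t x)
    (W := fun k x => W k fun s t => B s t x) (a := α) (c := 1 - A.μ) (C := C * K ^ 2) (D := D * K)
    (by linarith [hA.μ_lt_one]) (by positivity) (fun k => (hα0 k).le) (hα.not_summable hA)
    (hα.summable_sq hA) (fun k => (hfk k).1) (fun k => (hGk k).1) (fun k => (hfk k).2)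
    (fun k => (hGk k).2) (fun k => (hWk k).2) (fun _ _ => hf0 _) (fun _ _ => sq_nonneg _)
    (fun k => hbounds.mono fun x hx => (hx k).1) hcond
    (fun k => hbounds.mono fun x hx => (hx k).2)
  refine ⟨h1.mono fun x hx => ?_, h2⟩
  have := hx.sqrt
  simpa [G, Real.sqrt_sq] using this
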